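/- A super-orientation of a finite simple graph $G$ is a digraph $D$ on the same vertices obtained by orienting each edge of $G$ either in one direction or in both directions. It is clique-acyclic if no clique of $G$ contains a directed cycle consisting of arcs oriented in only one direction (arcs $(u,v)$ of $D$ such that $(v,u)$ is not an arc of $D$). A graph is chordal if it has no induced cycle of length $4$ or more. A kernel of a digraph is a set $K$ of vertices such that no two vertices of $K$ are adjacent and every vertex $u\notin K$ has an arc $(u,v)$ to some $v\in K$. Theorem. A kernel can be computed in polynomial time in clique-acyclic super-orientations of chordal graphs. That is, there exist a (random access machine) algorithm and a polynomial $p$ such that for every $n\ge 0$, every chordal graph $G$ on $n$ vertices and every clique-acyclic super-orientation $D$ of $G$, the algorithm, given (the adjacency matrix of) $D$, halts after at most $p(n)$ steps and returns a kernel of $D$. -/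

import Mathlib

/-! ### Digraphs, super-orientations, chordal graphs, kernels -/

/-- `D` is a super-orientation of the simple graph `G`: every edge of `G` is oriented in one
direction or in both directions, and `D` has no other arcs. -/
def Digraph.IsSuperOrientation {V : Type*} (D : Digraph V) (G : SimpleGraph V) : Prop :=
  ∀ u v, G.Adj u v ↔ (D.Adj u v ∨ D.Adj v u)

/-- The arc `(u, v)` is present and is oriented in only one direction. -/
def Digraph.OneWay {V : Type*} (D : Digraph V) (u v : V) : Prop :=
  D.Adj u v ∧ ¬ D.Adj v u

/-- The vertex set `C` contains a directed cycle `c 0 → c 1 → ⋯ → c k → c 0`, with distinct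
vertices, all of whose arcs are oriented in only one direction (the addition `i + 1` in
`Fin (k + 1)` is cyclic). -/
def Digraph.HasOneWayCycleIn {V : Type*} (D : Digraph V) (C : Set V) : Prop :=
  ∃ (k : ℕ) (c : Fin (k + 1) → V), Function.Injective c ∧
    (∀ i, c i ∈ C) ∧ ∀ i, D.OneWay (c i) (c (i + 1))

/-- `D`, a super-orientation of `G`, is clique-acyclic: no clique of `G` has a directed cycle
consisting of arcs oriented in only one direction. -/
def Digraph.IsCliqueAcyclic {V : Type*} (D : Digraph V) (G : SimpleGraph V) : Prop :=
  ∀ C : Set V, G.IsClique C → ¬ D.HasOneWayCycleIn C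

/-- A graph is chordal if it has no induced cycle of length `4` or more. -/
def SimpleGraph.IsChordalGraph {V : Type*} (G : SimpleGraph V) : Prop :=
  ∀ k : ℕ, 4 ≤ k → IsEmpty (SimpleGraph.cycleGraph k ↪g G)

/-- A set of vertices is stable if it contains no pair of adjacent vertices. -/
def Digraph.IsStable {V : Type*} (D : Digraph V) (S : Set V) : Prop :=
  ∀ u ∈ S, ∀ v ∈ S, ¬ D.Adj u v

/-- A set `S` of vertices is absorbing if every vertex outside `S` has an arc into `S`. -/
def Digraph.IsAbsorbing {V : Type*} (D : Digraph V) (S : Set V) : Prop :=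
  ∀ u, u ∉ S → ∃ v ∈ S, D.Adj u v

/-- A kernel is a set of vertices that is both stable and absorbing. -/
def Digraph.IsKernel {V : Type*} (D : Digraph V) (S : Set V) : Prop :=
  D.IsStable S ∧ D.IsAbsorbing S

/-! ### A random access machine with step count

The machine has registers (a program can mention only finitely many of them) and an
unbounded memory that is addressed through registers; all cells hold natural numbers. Arithmetic
is limited to constants, addition and truncated subtraction, so that the unit-cost measure below
is polynomially related to the running time of Turing machines. -/

namespace RAM

/-- The content of the registers and of the memory. -/
structure State where
  /-- The registers. -/
  reg : ℕ → ℕ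
  /-- The memory. -/
  mem : ℕ → ℕ

/-- Structured programs of the random access machine. -/
inductive Program where
  /-- Do nothing. -/
  | skip : Program
  /-- `reg r := k`. -/
  | const (r k : ℕ) : Program
  /-- `reg r := reg a`. -/
  | copy (r a : ℕ) : Program
  /-- `reg r := reg a + reg b`. -/
  | add (r a b : ℕ) : Program
  /-- `reg r := max (reg a - reg b) 0`. -/
  | sub (r a b : ℕ) : Program
  /-- `reg r := mem (reg a)`. -/
  | load (r a : ℕ) : Program
  /-- `mem (reg a) := reg r`. -/
  | store (a r : ℕ) : Program
  /-- Execute `P`, then `Q`. -/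
  | seq (P Q : Program) : Program
  /-- If `reg r ≠ 0`, execute `P`, otherwise `Q`. -/
  | ifNonzero (r : ℕ) (P Q : Program) : Program
  /-- As long as `reg r ≠ 0`, execute `P`. -/
  | whileNonzero (r : ℕ) (P : Program) : Program

/-- Write `x` into register `r`. -/
def State.setReg (s : State) (r x : ℕ) : State :=
  { s with reg := Function.update s.reg r x }

/-- Write `x` into memory cell `a`. -/
def State.setMem (s : State) (a x : ℕ) : State :=
  { s with mem := Function.update s.mem a x }

/-- `Runs P s t s'`: started in the state `s`, the program `P` halts after exactly `t` steps, in
the state `s'`. Every elementary instruction and every evaluation of a test takes one step. -/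
inductive Runs : Program → State → ℕ → State → Prop where
  | skip (s : State) : Runs .skip s 1 s
  | const (s : State) (r k : ℕ) : Runs (.const r k) s 1 (s.setReg r k)
  | copy (s : State) (r a : ℕ) : Runs (.copy r a) s 1 (s.setReg r (s.reg a))
  | add (s : State) (r a b : ℕ) : Runs (.add r a b) s 1 (s.setReg r (s.reg a + s.reg b))
  | sub (s : State) (r a b : ℕ) : Runs (.sub r a b) s 1 (s.setReg r (s.reg a - s.reg b))
  | load (s : State) (r a : ℕ) : Runs (.load r a) s 1 (s.setReg r (s.mem (s.reg a)))
  | store (s : State) (a r : ℕ) : Runs (.store a r) s 1 (s.setMem (s.reg a) (s.reg r))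
  | seq {P Q : Program} {s s' s'' : State} {t t' : ℕ}
      (hP : Runs P s t s') (hQ : Runs Q s' t' s'') : Runs (.seq P Q) s (t + t') s''
  | if_true {r : ℕ} {P Q : Program} {s s' : State} {t : ℕ}
      (h : s.reg r ≠ 0) (hP : Runs P s t s') : Runs (.ifNonzero r P Q) s (t + 1) s'
  | if_false {r : ℕ} {P Q : Program} {s s' : State} {t : ℕ}
      (h : s.reg r = 0) (hQ : Runs Q s t s') : Runs (.ifNonzero r P Q) s (t + 1) s'
  | while_true {r : ℕ} {P : Program} {s s' s'' : State} {t t' : ℕ}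
      (h : s.reg r ≠ 0) (hP : Runs P s t s') (hW : Runs (.whileNonzero r P) s' t' s'') :
      Runs (.whileNonzero r P) s (t + t' + 1) s''
  | while_false {r : ℕ} {P : Program} {s : State}
      (h : s.reg r = 0) : Runs (.whileNonzero r P) s 1 s

open Classical in
/-- The initial state for the digraph `D` on the vertices `0, …, n - 1`: register `0` holds `n`,
the memory cells `0, …, n² - 1` hold the adjacency matrix of `D` row by row, and everything
else is `0`. -/
noncomputable def inputState {n : ℕ} (D : Digraph (Fin n)) : State where
  reg := fun r => if r = 0 then n else 0
  mem := fun a => if ∃ i j : Fin n, a = i.val * n + j.val ∧ D.Adj i j then 1 else 0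

open Classical in
/-- The memory cells `0, …, n - 1` hold the characteristic vector of the vertex set `K`. -/
def State.Outputs {n : ℕ} (s : State) (K : Set (Fin n)) : Prop :=
  ∀ i : Fin n, s.mem i.val = if i ∈ K then 1 else 0

/-- The program `P`, given the digraph `D`, halts within `T` steps and returns a kernel of `D`. -/
def Program.ReturnsKernelWithin {n : ℕ} (P : Program) (D : Digraph (Fin n)) (T : ℕ) : Prop :=
  ∃ (t : ℕ) (s : State) (K : Set (Fin n)),
    Runs P (inputState D) t s ∧ t ≤ T ∧ s.Outputs K ∧ D.IsKernel K

end RAM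

/-! Let `v` be simplicial among the vertices still present. Its closed neighbourhood `C` is then a
clique. Let `M` consist of the vertices of `C` from which one-way arcs inside `C` lead to `v`,
including `v`. A vertex `u ≠ v` of `M` has an arc to `v`, since a one-way arc from `v` to `u` would
close a one-way cycle in a clique. It also has an arc to every `y` in `C` outside `M`, since a
one-way arc from `y` to `u` would put `y` into `M`. So, once `v` is selected and `M` deleted, `u`
has arcs to `v` and to all surviving neighbours of `v`; likewise `v` has arcs to all of the latter.

Repeat until no vertex is left, then go backwards through the selected vertices, putting `v` into
`K` exactly when no later neighbour of `v` is in `K`. Selected vertices are linearly ordered, so `K`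
is stable. A vertex deleted together with `v` is absorbed by `v` if `v ∈ K`, and otherwise by a
later neighbour of `v` in `K`. The invariant is `Digraph.Elimination`, with `extend` for one
deletion and `isKernel` for the conclusion. Simplicial vertices exist by Dirac's theorem,
`exists_isSimplicialIn`.

For the running time, the procedure is written in a small language: first-order definitions of
relations on the vertices, and `n`-fold iteration. Each fixed command compiles to a program with a
polynomial time bound (`Command.reaches_compile`). Iterating `n` times suffices because each closure
or elimination round gains a vertex or is already finished, and because the recursion for `K` has
depth at most `n`. -/

/-! ### Simplicial vertices in chordal graphs -/

/-- The graph with the edges of `G` that have both ends in `W`. -/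
def SimpleGraph.within {V : Type*} (G : SimpleGraph V) (W : Set V) : SimpleGraph V where
  Adj a b := G.Adj a b ∧ a ∈ W ∧ b ∈ W
  symm := ⟨fun _ _ h => ⟨h.1.symm, h.2.2, h.2.1⟩⟩
  loopless := ⟨fun _ h => G.loopless.irrefl _ h.1⟩

/-- The two parts of the walk bound the distances from `s` and to `t`; the triangle inequality makes
the first bound sharp. -/
theorem SimpleGraph.Walk.dist_getVert_of_length_eq_dist {V : Type*} {G : SimpleGraph V} {s t : V}
    (p : G.Walk s t) (hp : p.length = G.dist s t) {i : ℕ} (hi : i ≤ p.length) :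
    G.dist s (p.getVert i) = i := by
  have h1 : G.dist s (p.getVert i) ≤ i := by
    refine (dist_le (p.take i)).trans ?_
    simp
  have h2 : G.dist (p.getVert i) t ≤ p.length - i := by
    refine (dist_le (p.drop i)).trans ?_
    simp
  have h3 := (p.take i).reachable.dist_triangle_left t
  omega

/-- Otherwise a shortest path from `s` to `t` inside `W` has length `d ≥ 2`, and closing it up
through `x` gives an induced cycle of length `d + 2 ≥ 4`. Chords of the path are excluded by
distances, chords at `x` by `hW`. -/
theorem SimpleGraph.IsChordalGraph.adj_of_reachable_within {V : Type*} {G : SimpleGraph V}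
    (hG : G.IsChordalGraph) {x s t : V} {W : Set V} (hxs : G.Adj x s) (hxt : G.Adj x t)
    (hst : s ≠ t) (hxW : x ∉ W) (hW : ∀ w ∈ W, G.Adj x w → w = s ∨ w = t)
    (hr : (G.within W).Reachable s t) : G.Adj s t := by
  by_contra hadj
  obtain ⟨p, hp⟩ := hr.exists_walk_length_eq_dist
  set d := p.length with hd
  have hdist : ∀ i, i ≤ d → (G.within W).dist s (p.getVert i) = i := fun i hi =>
    p.dist_getVert_of_length_eq_dist hp hi
  have h1 : 1 < d := by
    rw [hp]
    exact hr.one_lt_dist_of_ne_of_not_adj hst fun h => hadj h.1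
  have hmem : ∀ i, i ≤ d → p.getVert i ∈ W := by
    intro i hi
    rcases Nat.lt_or_ge i d with h | h
    · exact (p.adj_getVert_succ h).2.1
    · have := (p.adj_getVert_succ (i := i - 1) (by omega)).2.2
      rwa [Nat.sub_add_cancel (by omega)] at this
  have hadj_le : ∀ i j, i ≤ d → j ≤ d → G.Adj (p.getVert i) (p.getVert j) → j ≤ i + 1 := by
    intro i j hi hj h
    have h' : (G.within W).Adj (p.getVert i) (p.getVert j) := ⟨h, hmem i hi, hmem j hj⟩
    have h2 := (p.take i).reachable.dist_triangle_left (p.getVert j)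
    rw [hdist i hi, hdist j hj, SimpleGraph.dist_eq_one_iff_adj.2 h'] at h2
    exact h2
  have hx : ∀ i, i ≤ d → (G.Adj x (p.getVert i) ↔ i = 0 ∨ i = d) := by
    intro i hi
    constructor
    · intro h
      rcases hW _ (hmem i hi) h with h | h
      · left
        rw [← hdist i hi, h, SimpleGraph.dist_self]
      · right
        rw [← hdist i hi, h, hp]
    · rintro (rfl | rfl)
      · simpa using hxs
      · rw [hd, p.getVert_length]
        exact hxt
  -- Positions `0, …, d` run along the path; the last position `d + 1` is `x`.
  let c : Fin (d + 2) → V := fun i => if i.val ≤ d then p.getVert i.val else x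
  have hc : Function.Injective c := by
    intro i j hij
    simp only [c] at hij
    apply Fin.ext
    have := i.2
    have := j.2
    split_ifs at hij with hi hj hj
    · rw [← hdist i hi, hij, hdist j hj]
    · exact absurd (hij ▸ hmem i hi) hxW
    · exact absurd (hij ▸ hmem j hj) hxW
    · omega
  refine (hG (d + 2) (by omega)).false ⟨⟨c, hc⟩, ?_⟩
  intro i j
  have hi2 := i.2
  have hj2 := j.2
  simp only [Function.Embedding.coeFn_mk, c]
  rw [SimpleGraph.cycleGraph_adj', Fin.sub_def, Fin.sub_def]
  simp only
  have hmod : ∀ a b : ℕ, a < d + 2 → b < d + 2 → ((d + 2 - b + a) % (d + 2) = 1 ↔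
      a = b + 1 ∨ (b = d + 1 ∧ a = 0)) := by
    intro a b ha hb
    rcases Nat.lt_or_ge a b with h | h
    · rw [Nat.mod_eq_of_lt (by omega)]
      omega
    · rw [show d + 2 - b + a = (a - b) + (d + 2) by omega, Nat.add_mod_right,
        Nat.mod_eq_of_lt (by omega)]
      omega
  rw [hmod _ _ hi2 hj2, hmod _ _ hj2 hi2]
  split_ifs with hi hj hj
  · constructor
    · intro h
      have h3 := hadj_le i j hi hj h
      have h4 := hadj_le j i hj hi h.symm
      have h5 : i.val ≠ j.val := fun h5 => G.loopless.irrefl _ (h5 ▸ h)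
      omega
    · rintro ((h | h) | (h | h))
      · rw [h]
        exact (p.adj_getVert_succ (by omega)).1.symm
      · omega
      · rw [h]
        exact (p.adj_getVert_succ (by omega)).1
      · omega
  · rw [G.adj_comm, hx i hi]
    omega
  · rw [hx j hj]
    omega
  · simp only [SimpleGraph.irrefl, false_iff]
    omega

/-- The neighbours of `v` in `U` form a clique. -/
def SimpleGraph.IsSimplicialIn {V : Type*} (G : SimpleGraph V) (U : Set V) (v : V) : Prop :=
  ∀ a ∈ U, ∀ b ∈ U, G.Adj v a → G.Adj v b → a ≠ b → G.Adj a b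

/-- Dirac's argument; avoiding a clique `S` is what makes the induction work. If `x` is adjacent to
the rest of `S` but not to some `y`, take the component `H` of `y` among the non-neighbours of `x`,
and its boundary `N`. Then `N` is a clique, and induction on `H ∪ N`, which misses `x`, gives a
simplicial vertex in `H`. It keeps this property in `U` because its neighbours all lie in `H ∪ N`,
and it is outside `S` because it is neither `x` nor a neighbour of `x`. -/
theorem SimpleGraph.IsChordalGraph.exists_isSimplicialIn_not_mem {V : Type*} {G : SimpleGraph V}
    (hG : G.IsChordalGraph) (m : ℕ) : ∀ (U S : Finset V), U.card ≤ m → S ⊆ U →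
      G.IsClique (S : Set V) → (∃ v ∈ U, v ∉ S) → ∃ v ∈ U, v ∉ S ∧ G.IsSimplicialIn U v := by
  classical
  induction m with
  | zero =>
    rintro U S hU - - ⟨v, hv, -⟩
    rw [Nat.le_zero, Finset.card_eq_zero] at hU
    simp [hU] at hv
  | succ m ih =>
    rintro U S hU hSU hS ⟨v₀, hv₀, hv₀S⟩
    by_cases hx : ∃ x ∈ U, (∀ s ∈ S, s ≠ x → G.Adj x s) ∧ ∃ y ∈ U, y ≠ x ∧ ¬ G.Adj x y
    · obtain ⟨x, hxU, hxS, y, hyU, hyx, hxy⟩ := hx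
      let R : Set V := {w | w ∈ U ∧ w ≠ x ∧ ¬ G.Adj x w}
      let H : Finset V := U.filter fun w => w ∈ R ∧ (G.within R).Reachable y w
      let N : Finset V := U.filter fun w => w ∉ H ∧ ∃ h ∈ H, G.Adj w h
      have hyH : y ∈ H := by
        simp only [H, Finset.mem_filter]
        exact ⟨hyU, ⟨hyU, hyx, hxy⟩, SimpleGraph.Reachable.refl _⟩
      have hHR : ∀ h ∈ H, h ∈ R := fun h hh => (Finset.mem_filter.1 hh).2.1
      have hclosed : ∀ h ∈ H, ∀ w ∈ R, G.Adj h w → w ∈ H := by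
        intro h hh w hw hadj
        refine Finset.mem_filter.2 ⟨hw.1, hw, (Finset.mem_filter.1 hh).2.2.trans ?_⟩
        exact SimpleGraph.Adj.reachable ⟨hadj, hHR h hh, hw⟩
      have hNx : ∀ w ∈ N, G.Adj x w := by
        intro w hw
        obtain ⟨hwU, hwH, h, hh, hadj⟩ := Finset.mem_filter.1 hw
        by_contra hxw
        refine hwH (hclosed h hh w ⟨hwU, ?_, hxw⟩ hadj.symm)
        rintro rfl
        exact (hHR h hh).2.2 hadj
      -- A walk in `R` that starts in `H` never leaves `H`, so it lives in every `W` containing `H`;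
      -- below, `W` is `H` with two boundary vertices added.
      have hHreach : ∀ (W : Set V), (H : Set V) ⊆ W → ∀ h ∈ H, (G.within W).Reachable y h := by
        intro W hW h hh
        obtain ⟨p⟩ := (Finset.mem_filter.1 hh).2.2
        have key : ∀ (a b : V) (p : (G.within R).Walk a b), a ∈ H →
            (G.within W).Reachable a b := by
          intro a b p
          induction p with
          | nil => exact fun _ => SimpleGraph.Reachable.refl _
          | cons hadj _ ih' =>
            intro ha
            have hb := hclosed _ ha _ hadj.2.2 hadj.1
            exact (SimpleGraph.Adj.reachable (G := G.within W)
              ⟨hadj.1, hW ha, hW hb⟩).trans (ih' hb)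
        exact key _ _ p hyH
      have hN : G.IsClique (N : Set V) := by
        intro s hs t ht hst
        have hxs := hNx s hs
        have hxt := hNx t ht
        obtain ⟨hsU, hsH, h, hh, hadj⟩ := Finset.mem_filter.1 hs
        obtain ⟨htU, htH, h', hh', hadj'⟩ := Finset.mem_filter.1 ht
        let W : Set V := (H : Set V) ∪ {s, t}
        have hHW : (H : Set V) ⊆ W := Set.subset_union_left
        have hsW : s ∈ W := Or.inr (by simp)
        have htW : t ∈ W := Or.inr (by simp)
        refine hG.adj_of_reachable_within (W := W) hxs hxt hst ?_ ?_ ?_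
        · rintro (h1 | h1 | h1)
          · exact (hHR x h1).2.1 rfl
          · exact hxs.ne h1
          · exact hxt.ne h1
        · rintro w (h1 | h1 | h1) hw
          · exact absurd hw (hHR w h1).2.2
          · exact Or.inl h1
          · exact Or.inr h1
        · have r1 : (G.within W).Adj s h := ⟨hadj, hsW, hHW hh⟩
          have r2 : (G.within W).Adj t h' := ⟨hadj', htW, hHW hh'⟩
          exact r1.reachable.trans ((hHreach W hHW h hh).symm.trans
            ((hHreach W hHW h' hh').trans r2.reachable.symm))
      have hcard : (H ∪ N).card ≤ m := by
        have : (H ∪ N) ⊂ U := by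
          refine (Finset.ssubset_iff_of_subset ?_).2 ⟨x, hxU, ?_⟩
          · exact Finset.union_subset (Finset.filter_subset _ _) (Finset.filter_subset _ _)
          · intro hx
            rcases Finset.mem_union.1 hx with h | h
            · exact (hHR x h).2.1 rfl
            · exact (hNx x h).ne rfl
        have := Finset.card_lt_card this
        omega
      obtain ⟨v, hv, hvN, hvs⟩ := ih (H ∪ N) N hcard Finset.subset_union_right hN
        ⟨y, Finset.mem_union_left _ hyH, fun h => (Finset.mem_filter.1 h).2.1 hyH⟩
      have hvH : v ∈ H := (Finset.mem_union.1 hv).resolve_right hvN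
      have hnb : ∀ a ∈ U, G.Adj v a → a ∈ H ∪ N := by
        intro a ha hva
        by_cases haH : a ∈ H
        · exact Finset.mem_union_left _ haH
        · exact Finset.mem_union_right _ (Finset.mem_filter.2 ⟨ha, haH, v, hvH, hva.symm⟩)
      refine ⟨v, (hHR v hvH).1, ?_, ?_⟩
      · intro hvS
        have := hHR v hvH
        exact this.2.2 (hxS v hvS this.2.1)
      · intro a ha b hb hva hvb
        exact hvs a (hnb a ha hva) b (hnb b hb hvb) hva hvb
    -- Here a vertex adjacent to the rest of `S` is adjacent to all of `U`. This applies to the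
    -- members of `S`, hence then to every vertex, so `U` is a clique.
    · push Not at hx
      have huniv : ∀ s ∈ S, ∀ y ∈ U, y ≠ s → G.Adj s y := fun s hs =>
        hx s (hSU hs) fun t ht hts => hS hs ht hts.symm
      refine ⟨v₀, hv₀, hv₀S, ?_⟩
      intro a ha b hb _ _ hab
      exact hx a ha (fun s hs hsa => (huniv s hs a ha hsa.symm).symm) b hb hab.symm

theorem SimpleGraph.IsChordalGraph.exists_isSimplicialIn {V : Type*} [Finite V]
    {G : SimpleGraph V} (hG : G.IsChordalGraph) {U : Set V} (hU : U.Nonempty) :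
    ∃ v ∈ U, G.IsSimplicialIn U v := by
  obtain ⟨u, hu⟩ := hU
  obtain ⟨v, hv, -, hs⟩ := hG.exists_isSimplicialIn_not_mem _ U.toFinite.toFinset ∅ le_rfl
    (by simp) (by simp) ⟨u, by simpa using hu, by simp⟩
  exact ⟨v, by simpa using hv, by simpa using hs⟩

/-! ### Acyclicity of the one-way arcs in a clique -/

/-- Iterating a choice of successors must repeat; the orbit of a periodic point over its minimal
period is the cycle. -/
theorem Digraph.hasOneWayCycleIn_of_forall_exists {V : Type*} [Finite V] (D : Digraph V)
    {C : Set V} (hC : C.Nonempty) (h : ∀ u ∈ C, ∃ v ∈ C, D.OneWay u v) :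
    D.HasOneWayCycleIn C := by
  classical
  choose! f hfC hf using h
  obtain ⟨u, hu⟩ := hC
  have hiter : ∀ i, f^[i] u ∈ C := by
    intro i
    induction i with
    | zero => exact hu
    | succ i ih =>
      rw [Function.iterate_succ_apply']
      exact hfC _ ih
  obtain ⟨i, j, hij, he⟩ := Finite.exists_ne_map_eq_of_infinite fun i => f^[i] u
  wlog hlt : i < j generalizing i j
  · exact this j i hij.symm he.symm (by omega)
  set x := f^[i] u with hx
  have hper : Function.IsPeriodicPt f (j - i) x := by
    change f^[j - i] x = x
    rw [hx, ← Function.iterate_add_apply, Nat.sub_add_cancel hlt.le]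
    exact he.symm
  have hpos : 0 < Function.minimalPeriod f x := hper.minimalPeriod_pos (by omega)
  obtain ⟨k, hk⟩ : ∃ k, Function.minimalPeriod f x = k + 1 := ⟨_, (Nat.sub_add_cancel hpos).symm⟩
  have hmem : ∀ l, f^[l] x ∈ C := fun l => by
    rw [hx, ← Function.iterate_add_apply]
    exact hiter _
  refine ⟨k, fun l => f^[l.val] x, ?_, fun l => hmem _, ?_⟩
  · intro a b hab
    apply Fin.ext
    apply Function.iterate_injOn_Iio_minimalPeriod (f := f) (x := x) _ _ hab
    · rw [hk]
      exact a.2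
    · rw [hk]
      exact b.2
  -- The cyclic `l + 1` is reduced modulo the minimal period, which does not change the iterate.
  · intro l
    have hval : f^[(l + 1).val] x = f (f^[l.val] x) := by
      have hmod := Function.iterate_mod_minimalPeriod_eq (f := f) (x := x) (n := l.val + 1)
      rw [hk] at hmod
      rw [← Function.iterate_succ_apply' f, Fin.val_add, Fin.val_one', Nat.add_mod_mod, hmod]
    simp only [hval]
    exact hf _ (hmem _)

theorem Digraph.IsCliqueAcyclic.not_oneWay_of_reflTransGen {V : Type*} [Finite V] {D : Digraph V}
    {G : SimpleGraph V} (hD : D.IsCliqueAcyclic G) {C : Set V} (hC : G.IsClique C) {u v : V}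
    (hu : u ∈ C) (hv : v ∈ C)
    (h : Relation.ReflTransGen (fun a b => D.OneWay a b ∧ a ∈ C ∧ b ∈ C) u v) :
    ¬ D.OneWay v u := by
  intro hvu
  refine hD C hC ?_
  let r : V → V → Prop := fun a b => D.OneWay a b ∧ a ∈ C ∧ b ∈ C
  -- Every vertex of `T` has a one-way successor in `T`: follow its path to `u`; from `u` follow the
  -- path to `v`, or use the arc `v → u` if `u = v`.
  let T : Set V := {x | x ∈ C ∧ Relation.ReflTransGen r x u}
  have hr : r v u := ⟨hvu, hv, hu⟩
  obtain ⟨k, c, h1, h2, h3⟩ : D.HasOneWayCycleIn T := by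
    refine D.hasOneWayCycleIn_of_forall_exists ⟨u, hu, .refl⟩ ?_
    rintro x ⟨hxC, hxu⟩
    rcases Relation.ReflTransGen.cases_head hxu with rfl | ⟨y, hxy, hyu⟩
    · rcases Relation.ReflTransGen.cases_head h with rfl | ⟨y, hxy, hyv⟩
      · exact ⟨x, ⟨hu, .refl⟩, hvu⟩
      · exact ⟨y, ⟨hxy.2.2, hyv.tail hr⟩, hxy.1⟩
    · exact ⟨y, ⟨hxy.2.2, hyu⟩, hxy.1⟩
  exact ⟨k, c, h1, fun i => (h2 i).1, h3⟩

/-! ### A first-order language with iteration -/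

namespace RAM

/-- First-order formulas over indexed binary relations; the variables are natural numbers, and a
quantifier at depth `d` binds the variable `d`. -/
inductive Formula where
  | rel (k i j : ℕ) : Formula
  | lt (i j : ℕ) : Formula
  | neg (φ : Formula) : Formula
  | and (φ ψ : Formula) : Formula
  | ex (φ : Formula) : Formula

/-- Indexed binary relations on `Fin n`. -/
abbrev Relations (n : ℕ) := ℕ → Fin n → Fin n → Prop

/-- The truth value of a formula at quantifier depth `d`. -/
def Formula.eval {n : ℕ} (A : Relations n) : Formula → ℕ → (ℕ → Fin n) → Prop
  | rel k i j, _, e => A k (e i) (e j)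
  | lt i j, _, e => e i < e j
  | neg φ, d, e => ¬ φ.eval A d e
  | and φ ψ, d, e => φ.eval A d e ∧ ψ.eval A d e
  | ex φ, d, e => ∃ x, φ.eval A (d + 1) (Function.update e d x)

/-- Commands: redefine a relation by a formula in the variables `0` and `1`, execute two commands
in sequence, or repeat a command as often as there are vertices. -/
inductive Command where
  | assign (k : ℕ) (φ : Formula) : Command
  | seq (c d : Command) : Command
  | iter (c : Command) : Command

/-- The effect of a command. -/
def Command.eval {n : ℕ} [NeZero n] : Command → Relations n → Relations n
  | assign k φ, A => Function.update A k fun x y =>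
      φ.eval A 2 (Function.update (Function.update (fun _ => 0) 0 x) 1 y)
  | seq c d, A => d.eval (c.eval A)
  | iter c, A => c.eval^[n] A

/-! ### Compilation to the random access machine

Register `0` holds `n`, register `1` holds `1`, register `2` holds truth values, register `3` holds
`n²`, register `4` holds addresses. The variable `j` is held by register `5 + 4 j`, and its product
with `n` by register `6 + 4 j`; registers `7 + 4 j` and `8 + 4 j` are a flag and a counter. The
relation `k` is stored from address `2 k n²` on. -/

/-- Add `k` times the content of register `3` to register `4`. -/
def Program.addSquares : ℕ → Program
  | 0 => .skip
  | k + 1 => .seq (.add 4 4 3) (addSquares k)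

/-- Put the address of the entry at the variables `i`, `j` in block `k` into register `4`. -/
def Program.address (k i j : ℕ) : Program :=
  .seq (.add 4 (6 + 4 * i) (5 + 4 * j)) (.addSquares k)

/-- Execute `P` with the variable `d` running through `n - 1, …, 0`. -/
def Program.forVar (d : ℕ) (P : Program) : Program :=
  .seq (.copy (5 + 4 * d) 0) (.seq (.copy (6 + 4 * d) 3)
    (.whileNonzero (5 + 4 * d)
      (.seq (.sub (5 + 4 * d) (5 + 4 * d) 1) (.seq (.sub (6 + 4 * d) (6 + 4 * d) 0) P))))

/-- A program that evaluates a formula at depth `d` into register `2`. -/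
def Formula.compile : Formula → ℕ → Program
  | rel k i j, _ => .seq (.address (2 * k) i j) (.load 2 4)
  | lt i j, _ => .seq (.sub 2 (5 + 4 * j) (5 + 4 * i))
      (.ifNonzero 2 (.const 2 1) (.const 2 0))
  | neg φ, d => .seq (φ.compile d) (.sub 2 1 2)
  | and φ ψ, d => .seq (φ.compile d) (.ifNonzero 2 (ψ.compile d) .skip)
  | ex φ, d => .seq (.const (7 + 4 * d) 0)
      (.seq (.forVar d (.seq (φ.compile (d + 1)) (.ifNonzero 2 (.const (7 + 4 * d) 1) .skip)))
        (.copy 2 (7 + 4 * d)))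

/-- Copy the block `1` to the block `2 k`. -/
def Program.copyBlock (k : ℕ) : Program :=
  .forVar 0 (.forVar 1 (.seq (.address 1 0 1) (.seq (.load 2 4)
    (.seq (.address (2 * k) 0 1) (.store 4 2)))))

/-- A program for a command inside of `d` iterations. -/
def Command.compile : Command → ℕ → Program
  | assign k φ, _ => .seq
      (.forVar 0 (.forVar 1 (.seq (φ.compile 2) (.seq (.address 1 0 1) (.store 4 2)))))
      (.copyBlock k)
  | seq c c', d => .seq (c.compile d) (c'.compile d)
  | iter c, d => .seq (.copy (8 + 4 * d) 0)
      (.whileNonzero (8 + 4 * d) (.seq (.sub (8 + 4 * d) (8 + 4 * d) 1) (c.compile (d + 1))))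

/-! ### Total correctness with time bounds -/

/-- Started in `s`, the program `P` halts within `T` steps in a state that satisfies `Q`. -/
def Reaches (P : Program) (s : State) (T : ℕ) (Q : State → Prop) : Prop :=
  ∃ t s', Runs P s t s' ∧ t ≤ T ∧ Q s'

theorem Reaches.mono {P : Program} {s : State} {T T' : ℕ} {Q Q' : State → Prop}
    (h : Reaches P s T Q) (hT : T ≤ T') (hQ : ∀ s', Q s' → Q' s') : Reaches P s T' Q' := by
  obtain ⟨t, s', h1, h2, h3⟩ := h
  exact ⟨t, s', h1, h2.trans hT, hQ _ h3⟩

theorem Reaches.seq {P P' : Program} {s : State} {T T' : ℕ} {Q Q' : State → Prop}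
    (h : Reaches P s T Q) (h' : ∀ s', Q s' → Reaches P' s' T' Q') :
    Reaches (.seq P P') s (T + T') Q' := by
  obtain ⟨t, s', h1, h2, h3⟩ := h
  obtain ⟨t', s'', h4, h5, h6⟩ := h' s' h3
  exact ⟨_, _, .seq h1 h4, by omega, h6⟩

/-- The invariant is indexed by the loop register, which counts the remaining rounds and thereby
bounds the time. -/
theorem Reaches.while {r : ℕ} {P : Program} {T : ℕ} (I : ℕ → State → Prop)
    (hI : ∀ i s, I i s → s.reg r = i)
    (h : ∀ i s, I (i + 1) s → Reaches P s T (I i)) (m : ℕ) :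
    ∀ s, I m s → Reaches (.whileNonzero r P) s ((T + 1) * m + 1) (I 0) := by
  induction m with
  | zero => exact fun s hs => ⟨_, _, .while_false (hI _ _ hs), by omega, hs⟩
  | succ m ih =>
    intro s hs
    obtain ⟨t, s', h1, h2, h3⟩ := h m s hs
    obtain ⟨t', s'', h4, h5, h6⟩ := ih s' h3
    refine ⟨_, _, .while_true (by rw [hI _ _ hs]; omega) h1 h4, ?_, h6⟩
    rw [Nat.mul_succ]
    omega

theorem Runs.reaches {P : Program} {s s' : State} {t T : ℕ} {Q : State → Prop}
    (h : Runs P s t s') (ht : t ≤ T) (hQ : Q s') : Reaches P s T Q :=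
  ⟨t, s', h, ht, hQ⟩

theorem State.reg_setReg_self (s : State) (r x : ℕ) : (s.setReg r x).reg r = x := by
  simp [State.setReg]

theorem State.reg_setReg_of_ne (s : State) {q r : ℕ} (x : ℕ) (h : q ≠ r) :
    (s.setReg r x).reg q = s.reg q := by
  simp [State.setReg, h]

theorem State.mem_setReg (s : State) (r x : ℕ) : (s.setReg r x).mem = s.mem := rfl

/-- The registers hold the dimension `n` and the variables `e`. -/
structure RegsHold (n : ℕ) (e : ℕ → ℕ) (s : State) : Prop where
  dim : s.reg 0 = n
  one : s.reg 1 = 1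
  square : s.reg 3 = n * n
  var (j : ℕ) : s.reg (5 + 4 * j) = e j
  mulVar (j : ℕ) : s.reg (6 + 4 * j) = n * e j

theorem RegsHold.setReg {n : ℕ} {e : ℕ → ℕ} {s : State} (h : RegsHold n e s) {r : ℕ} (x : ℕ)
    (hr : r = 2 ∨ r = 4 ∨ ∃ j, r = 7 + 4 * j ∨ r = 8 + 4 * j) : RegsHold n e (s.setReg r x) := by
  have hr' : r ≠ 0 ∧ r ≠ 1 ∧ r ≠ 3 ∧ ∀ j, r ≠ 5 + 4 * j ∧ r ≠ 6 + 4 * j := by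
    refine ⟨?_, ?_, ?_, fun j => ?_⟩ <;> rcases hr with hr | hr | ⟨i, hr | hr⟩ <;> omega
  obtain ⟨h0, h1, h3, hv⟩ := hr'
  constructor
  · rw [s.reg_setReg_of_ne x h0.symm, h.dim]
  · rw [s.reg_setReg_of_ne x h1.symm, h.one]
  · rw [s.reg_setReg_of_ne x h3.symm, h.square]
  · intro j
    rw [s.reg_setReg_of_ne x (hv j).1.symm, h.var]
  · intro j
    rw [s.reg_setReg_of_ne x (hv j).2.symm, h.mulVar]

theorem RegsHold.setMem {n : ℕ} {e : ℕ → ℕ} {s : State} (h : RegsHold n e s) (a x : ℕ) :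
    RegsHold n e (s.setMem a x) :=
  ⟨h.dim, h.one, h.square, h.var, h.mulVar⟩

theorem RegsHold.setVar {n : ℕ} {e : ℕ → ℕ} {s : State} (h : RegsHold n e s) (d x : ℕ) :
    RegsHold n (Function.update e d x) ((s.setReg (5 + 4 * d) x).setReg (6 + 4 * d) (n * x)) := by
  constructor
  · rw [State.reg_setReg_of_ne _ _ (by omega), State.reg_setReg_of_ne _ _ (by omega), h.dim]
  · rw [State.reg_setReg_of_ne _ _ (by omega), State.reg_setReg_of_ne _ _ (by omega), h.one]
  · rw [State.reg_setReg_of_ne _ _ (by omega), State.reg_setReg_of_ne _ _ (by omega), h.square]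
  · intro j
    rw [State.reg_setReg_of_ne _ _ (by omega)]
    rcases eq_or_ne j d with rfl | hj
    · rw [State.reg_setReg_self, Function.update_self]
    · rw [State.reg_setReg_of_ne _ _ (by omega), h.var, Function.update_of_ne hj]
  · intro j
    rcases eq_or_ne j d with rfl | hj
    · rw [State.reg_setReg_self, Function.update_self]
    · rw [State.reg_setReg_of_ne _ _ (by omega), State.reg_setReg_of_ne _ _ (by omega), h.mulVar,
        Function.update_of_ne hj]

theorem RegsHold.runs_addSquares {n : ℕ} {e : ℕ → ℕ} (k : ℕ) : ∀ {s : State}, RegsHold n e s →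
    Runs (.addSquares k) s (k + 1) (s.setReg 4 (s.reg 4 + n * n * k)) := by
  induction k with
  | zero =>
    intro s _
    have : s.setReg 4 (s.reg 4 + n * n * 0) = s := by
      simp [State.setReg]
    rw [this]
    exact .skip s
  | succ k ih =>
    intro s h
    have h1 := Runs.add s 4 4 3
    have h2 := ih (h.setReg (r := 4) (s.reg 4 + s.reg 3) (by omega))
    convert Runs.seq h1 h2 using 1
    · rfl
    · omega
    · rw [State.reg_setReg_self, h.square]
      simp only [State.setReg, Function.update_idem]
      congr 2
      ring

theorem RegsHold.runs_address {n : ℕ} {e : ℕ → ℕ} {s : State} (h : RegsHold n e s) (k i j : ℕ) :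
    Runs (.address k i j) s (k + 2) (s.setReg 4 (n * n * k + (n * e i + e j))) := by
  have h1 := Runs.add s 4 (6 + 4 * i) (5 + 4 * j)
  have h2 := (h.setReg (r := 4) (s.reg (6 + 4 * i) + s.reg (5 + 4 * j))
    (by omega)).runs_addSquares k
  convert Runs.seq h1 h2 using 1
  · rfl
  · ring
  · rw [State.reg_setReg_self, h.var, h.mulVar]
    simp only [State.setReg, Function.update_idem]
    congr 2
    ring

/-- Counting down leaves the variable at `0`, its value in `e`, so the registers are restored. The
product with `n` is updated by subtracting `n`, as the machine cannot multiply. In `J i`, the values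
from `i` upwards have been processed. -/
theorem Reaches.forVar {d n T : ℕ} {P : Program} {e : ℕ → ℕ} (he : e d = 0)
    (J : ℕ → State → Prop)
    (h : ∀ i s, i < n → J (i + 1) s → RegsHold n (Function.update e d i) s →
      Reaches P s T fun s' => J i s' ∧ RegsHold n (Function.update e d i) s')
    (hJ : ∀ i s r x, (r = 5 + 4 * d ∨ r = 6 + 4 * d) → J i s → J i (s.setReg r x))
    {s : State} (hs : J n s) (hr : RegsHold n e s) :
    Reaches (.forVar d P) s ((T + 3) * n + 3) fun s' => J 0 s' ∧ RegsHold n e s' := by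
  have key := Reaches.while (r := 5 + 4 * d)
    (P := .seq (.sub (5 + 4 * d) (5 + 4 * d) 1) (.seq (.sub (6 + 4 * d) (6 + 4 * d) 0) P))
    (T := T + 2)
    (fun i s => i ≤ n ∧ J i s ∧ RegsHold n (Function.update e d i) s)
    (fun i s hs => by rw [hs.2.2.var, Function.update_self]) ?_ n
    ((s.setReg (5 + 4 * d) n).setReg (6 + 4 * d) (n * n)) ?_
  · obtain ⟨t, s', ht, hle, -, hs'⟩ := key
    have r1 := Runs.copy s (5 + 4 * d) 0
    have r2 := Runs.copy (s.setReg (5 + 4 * d) n) (6 + 4 * d) 3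
    rw [hr.dim] at r1
    rw [State.reg_setReg_of_ne _ _ (by omega), hr.square] at r2
    rw [show T + 2 + 1 = T + 3 from rfl] at hle
    refine ⟨_, s', .seq r1 (.seq r2 ht), by omega, hs'.1, ?_⟩
    have := hs'.2
    rwa [← he, Function.update_eq_self] at this
  · rintro i s ⟨hi, hJs, hr⟩
    have hr' := hr.setVar d i
    rw [Function.update_idem] at hr'
    obtain ⟨t, s', ht, hle, hs'⟩ := h i ((s.setReg (5 + 4 * d) i).setReg (6 + 4 * d) (n * i)) hi
      (hJ _ _ _ _ (.inr rfl) (hJ _ _ _ _ (.inl rfl) hJs)) hr'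
    have r1 := Runs.sub s (5 + 4 * d) (5 + 4 * d) 1
    have r2 := Runs.sub (s.setReg (5 + 4 * d) i) (6 + 4 * d) (6 + 4 * d) 0
    rw [hr.var, hr.one, Function.update_self, Nat.add_sub_cancel] at r1
    rw [State.reg_setReg_of_ne _ _ (by omega), State.reg_setReg_of_ne _ _ (by omega), hr.mulVar,
      hr.dim, Function.update_self, Nat.mul_succ, Nat.add_sub_cancel] at r2
    exact ⟨_, s', .seq r1 (.seq r2 ht), by omega, by omega, hs'⟩
  · exact ⟨le_rfl, hJ _ _ _ _ (.inr rfl) (hJ _ _ _ _ (.inl rfl) hs), hr.setVar d n⟩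

/-- The pair of variables acts as the single downward counter `n * x + y`; the start of an inner
loop, `n * x + n`, is the outer index `n * (x + 1)`. -/
theorem Reaches.forVar_forVar {n T : ℕ} {P : Program} (J : ℕ → State → Prop)
    (h : ∀ x y s, x < n → y < n → J (n * x + y + 1) s →
      RegsHold n (Function.update (Function.update 0 0 x) 1 y) s →
      Reaches P s T fun s' => J (n * x + y) s' ∧
        RegsHold n (Function.update (Function.update 0 0 x) 1 y) s')
    (hJ : ∀ i s r x, (∃ d, r = 5 + 4 * d ∨ r = 6 + 4 * d) → J i s → J i (s.setReg r x))
    {s : State} (hs : J (n * n) s) (hr : RegsHold n 0 s) :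
    Reaches (.forVar 0 (.forVar 1 P)) s (((T + 3) * n + 6) * n + 3)
      fun s' => J 0 s' ∧ RegsHold n 0 s' := by
  refine (Reaches.forVar (T := (T + 3) * n + 3) rfl (fun i => J (n * i)) ?_ ?_ hs hr).mono
    le_rfl fun s' hs' => hs'
  · intro x s hx hs hr
    refine Reaches.forVar (by simp) (fun j => J (n * x + j)) ?_ ?_ hs hr
    · exact fun y s hy hs hr => h x y s hx hy hs hr
    · exact fun i s r z hr => hJ _ _ _ _ ⟨_, hr⟩
  · exact fun i s r z hr => hJ _ _ _ _ ⟨_, hr⟩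

/-! ### Correctness of the compilation -/

open Classical in
/-- The memory holds the relations `A`. -/
def MemHolds {n : ℕ} (A : Relations n) (s : State) : Prop :=
  ∀ k (x y : Fin n), s.mem (n * n * (2 * k) + (n * x + y)) = if A k x y then 1 else 0

/-- The flags below depth `d` and the counters agree. -/
def Keeps (d : ℕ) (s s' : State) : Prop :=
  (∀ j < d, s'.reg (7 + 4 * j) = s.reg (7 + 4 * j)) ∧ ∀ j, s'.reg (8 + 4 * j) = s.reg (8 + 4 * j)

theorem Keeps.refl (d : ℕ) (s : State) : Keeps d s s := ⟨fun _ _ => rfl, fun _ => rfl⟩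

theorem Keeps.trans {d : ℕ} {s s' s'' : State} (h : Keeps d s s') (h' : Keeps d s' s'') :
    Keeps d s s'' :=
  ⟨fun j hj => (h'.1 j hj).trans (h.1 j hj), fun j => (h'.2 j).trans (h.2 j)⟩

theorem Keeps.mono {d d' : ℕ} {s s' : State} (h : Keeps d s s') (hd : d' ≤ d) : Keeps d' s s' :=
  ⟨fun j hj => h.1 j (by omega), h.2⟩

theorem Keeps.setReg {d : ℕ} {s s' : State} (h : Keeps d s s') {r : ℕ} (x : ℕ)
    (hr : r = 2 ∨ r = 4 ∨ r = 7 + 4 * d ∨ ∃ j, r = 5 + 4 * j ∨ r = 6 + 4 * j) :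
    Keeps d s (s'.setReg r x) := by
  constructor
  · intro j hj
    rw [State.reg_setReg_of_ne _ _ (by rcases hr with hr | hr | hr | ⟨i, hr | hr⟩ <;> omega),
      h.1 j hj]
  · intro j
    rw [State.reg_setReg_of_ne _ _ (by rcases hr with hr | hr | hr | ⟨i, hr | hr⟩ <;> omega),
      h.2 j]

theorem coe_update {n : ℕ} (e : ℕ → Fin n) (d : ℕ) (x : Fin n) :
    (fun j => (Function.update e d x j : ℕ)) = Function.update (fun j => (e j : ℕ)) d x := by
  funext j
  rcases eq_or_ne j d with rfl | h
  · simp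
  · simp [h]

-- The polynomial depends on the formula only. Variables from `d` on are `0` beforehand, so the
-- quantifier at depth `d` may use variable `d`; `Keeps` protects the flags of the enclosing
-- quantifiers.
open Classical in
theorem Formula.reaches_compile (φ : Formula) : ∃ p : Polynomial ℕ, ∀ (n : ℕ) (A : Relations n)
    (d : ℕ) (e : ℕ → Fin n) (s : State), (∀ j, d ≤ j → (e j : ℕ) = 0) →
    RegsHold n (fun j => e j) s → MemHolds A s →
    Reaches (φ.compile d) s (p.eval n) fun s' => s'.mem = s.mem ∧ RegsHold n (fun j => e j) s' ∧
      Keeps d s s' ∧ s'.reg 2 = if φ.eval A d e then 1 else 0 := by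
  induction φ with
  | rel k i j =>
    refine ⟨Polynomial.C (4 * k + 3), ?_⟩
    intro n A d e s _ hr hm
    refine Runs.reaches (.seq (hr.runs_address (2 * k) i j) (.load _ 2 4)) ?_ ⟨rfl,
      (hr.setReg _ (by omega)).setReg _ (by omega),
      ((Keeps.refl d s).setReg _ (by omega)).setReg _ (by omega), ?_⟩
    · rw [Polynomial.eval_C]
      omega
    · rw [State.reg_setReg_self, State.reg_setReg_self, State.mem_setReg, hm]
      rfl
  | lt i j =>
    refine ⟨Polynomial.C 3, ?_⟩
    intro n A d e s _ hr hm
    have r1 := Runs.sub s 2 (5 + 4 * j) (5 + 4 * i)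
    rw [hr.var, hr.var] at r1
    rw [Polynomial.eval_C]
    by_cases h : e i < e j
    · refine Runs.reaches (.seq r1 (.if_true ?_ (.const _ 2 1))) le_rfl ⟨rfl,
        (hr.setReg _ (by omega)).setReg _ (by omega),
        ((Keeps.refl d s).setReg _ (by omega)).setReg _ (by omega), ?_⟩
      · rw [State.reg_setReg_self]
        have := Fin.lt_def.1 h
        omega
      · exact (State.reg_setReg_self _ _ _).trans (if_pos h).symm
    · refine Runs.reaches (.seq r1 (.if_false ?_ (.const _ 2 0))) le_rfl ⟨rfl,
        (hr.setReg _ (by omega)).setReg _ (by omega),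
        ((Keeps.refl d s).setReg _ (by omega)).setReg _ (by omega), ?_⟩
      · rw [State.reg_setReg_self]
        have := fun h' => h (Fin.lt_def.2 h')
        omega
      · exact (State.reg_setReg_self _ _ _).trans (if_neg h).symm
  | neg φ ih =>
    obtain ⟨p, hp⟩ := ih
    refine ⟨p + Polynomial.C 1, ?_⟩
    intro n A d e s he hr hm
    rw [Polynomial.eval_add, Polynomial.eval_C]
    refine (hp n A d e s he hr hm).seq ?_
    rintro s' ⟨hm', hr', hk, h2⟩
    refine (Runs.sub s' 2 1 2).reaches le_rfl ⟨hm', hr'.setReg _ (by omega),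
      hk.setReg _ (by omega), ?_⟩
    rw [State.reg_setReg_self, hr'.one, h2]
    by_cases h : φ.eval A d e <;> simp [Formula.eval, h]
  | and φ ψ ih ih' =>
    obtain ⟨p, hp⟩ := ih
    obtain ⟨q, hq⟩ := ih'
    refine ⟨p + (q + Polynomial.C 2), ?_⟩
    intro n A d e s he hr hm
    rw [Polynomial.eval_add]
    refine (hp n A d e s he hr hm).seq ?_
    rintro s' ⟨hm', hr', hk, h2⟩
    rw [Polynomial.eval_add, Polynomial.eval_C]
    by_cases h : φ.eval A d e
    · have hms : MemHolds A s' := fun k x y => by rw [hm', hm]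
      obtain ⟨t, s'', ht, hle, hm'', hr'', hk', h2'⟩ := hq n A d e s' he hr' hms
      refine (Runs.if_true (by simp [h2, h]) ht).reaches (by omega) ⟨hm''.trans hm', hr'',
        hk.trans hk', ?_⟩
      rw [h2']
      simp [Formula.eval, h]
    · refine (Runs.if_false (by simp [h2, h]) (.skip s')).reaches (by omega) ⟨hm', hr', hk, ?_⟩
      rw [h2]
      simp [Formula.eval, h]
  | ex φ ih =>
    obtain ⟨p, hp⟩ := ih
    refine ⟨(p + Polynomial.C 5) * Polynomial.X + Polynomial.C 5, ?_⟩
    intro n A d e s he hr hm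
    simp only [Polynomial.eval_add, Polynomial.eval_mul, Polynomial.eval_C, Polynomial.eval_X]
    -- The flag tells whether a witness has been found among the values `x ≥ i` tried so far.
    let J : ℕ → State → Prop := fun i s' => s'.mem = s.mem ∧ Keeps d s s' ∧
      s'.reg (7 + 4 * d) =
        if ∃ x : Fin n, i ≤ x.val ∧ φ.eval A (d + 1) (Function.update e d x) then 1 else 0
    refine Reaches.mono (T := 1 + (((p.eval n + 2 + 3) * n + 3) + 1)) (Reaches.seq (Q := fun s' =>
      J n s' ∧ RegsHold n (fun j => e j) s') ?_ fun s₁ hs₁ => ((Reaches.forVar (T := p.eval n + 2)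
      (he d le_rfl) J ?_ ?_ hs₁.1 hs₁.2).seq ?_)) ?_ fun _ h => h
    · refine (Runs.const s (7 + 4 * d) 0).reaches le_rfl ⟨⟨rfl,
        (Keeps.refl d s).setReg _ (by omega), ?_⟩, hr.setReg _ (.inr (.inr ⟨d, .inl rfl⟩))⟩
      rw [State.reg_setReg_self, if_neg]
      rintro ⟨x, hx, -⟩
      exact absurd x.2 (by omega)
    · rintro i s₂ hi ⟨hm₂, hk₂, hf₂⟩ hr₂
      have hms : MemHolds A s₂ := fun k x y => by rw [hm₂, hm]
      have hupd := coe_update e d ⟨i, hi⟩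
      rw [← hupd] at hr₂ ⊢
      refine (hp n A (d + 1) (Function.update e d ⟨i, hi⟩) s₂ ?_ hr₂ hms).seq ?_
      · intro j hj
        rw [Function.update_of_ne (by omega)]
        exact he j (by omega)
      · rintro s₃ ⟨hm₃, hr₃, hk₃, h2⟩
        have hf₃ := (hk₃.1 d (by omega)).trans hf₂
        have hk₃' := hk₂.trans (hk₃.mono (Nat.le_succ d))
        by_cases h : φ.eval A (d + 1) (Function.update e d ⟨i, hi⟩)
        · refine (Runs.if_true (by simp [h2, h]) (.const _ _ _)).reaches le_rfl ⟨⟨hm₃.trans hm₂,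
            hk₃'.setReg _ (by omega), ?_⟩, hr₃.setReg _ (.inr (.inr ⟨d, .inl rfl⟩))⟩
          rw [State.reg_setReg_self, if_pos ⟨⟨i, hi⟩, le_rfl, h⟩]
        · refine (Runs.if_false (by simp [h2, h]) (.skip _)).reaches le_rfl
            ⟨⟨hm₃.trans hm₂, hk₃', ?_⟩, hr₃⟩
          rw [hf₃]
          congr 1
          refine propext (exists_congr fun x => ⟨fun hx => ⟨by omega, hx.2⟩, fun hx => ⟨?_, hx.2⟩⟩)
          rcases Nat.lt_or_ge i x with hlt | hge
          · exact hlt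
          · refine absurd ?_ h
            have : x = ⟨i, hi⟩ := Fin.ext (by simp only; omega)
            exact this ▸ hx.2
    · rintro i s' r x hr' ⟨h1, h2, h3⟩
      refine ⟨h1, h2.setReg _ (.inr (.inr (.inr ⟨d, hr'⟩))), ?_⟩
      rw [State.reg_setReg_of_ne _ _ (by omega), h3]
    · rintro s₂ ⟨⟨hm₂, hk₂, hf₂⟩, hr₂⟩
      refine (Runs.copy s₂ 2 (7 + 4 * d)).reaches le_rfl ⟨hm₂, hr₂.setReg _ (by omega),
        hk₂.setReg _ (by omega), ?_⟩
      rw [State.reg_setReg_self, hf₂]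
      congr 1
      simp [Formula.eval]
    · rw [show p.eval n + 2 + 3 = p.eval n + 5 from rfl]
      omega

/-- Two divisions with remainder by `n`. In particular, different blocks of memory are disjoint. -/
theorem address_inj {n k k' : ℕ} {x y x' y' : Fin n}
    (h : n * n * k + (n * x.val + y.val) = n * n * k' + (n * x'.val + y'.val)) :
    k = k' ∧ x = x' ∧ y = y' := by
  have hn : 0 < n := x.pos
  have hb : ∀ {u v : ℕ} {a b : Fin n}, n * u + a.val = n * v + b.val → u = v ∧ a = b := by
    intro u v a b h
    have h1 := congrArg (· / n) h
    have h2 := congrArg (· % n) h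
    simp only [Nat.mul_add_div hn, Nat.mul_add_mod, Nat.div_eq_of_lt a.2, Nat.div_eq_of_lt b.2,
      Nat.mod_eq_of_lt a.2, Nat.mod_eq_of_lt b.2, Nat.add_zero] at h1 h2
    exact ⟨h1, Fin.ext h2⟩
  have h' : n * (n * k + x.val) + y.val = n * (n * k' + x'.val) + y'.val := by
    linarith
  obtain ⟨h1, h2⟩ := hb h'
  obtain ⟨h3, h4⟩ := hb h1
  exact ⟨h3, h4, h2⟩

theorem mul_add_inj {n : ℕ} {x y x' y' : Fin n}
    (h : n * x.val + y.val = n * x'.val + y'.val) : x = x' ∧ y = y' :=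
  (address_inj (k := 0) (k' := 0) (by omega)).2

open Classical in
/-- The auxiliary block of the memory holds the part of `B` with indices at least `m`. -/
def AuxHolds {n : ℕ} (B : Fin n → Fin n → Prop) (m : ℕ) (s : State) : Prop :=
  ∀ x y : Fin n, m ≤ n * x + y → s.mem (n * n * 1 + (n * x + y)) = if B x y then 1 else 0

theorem reaches_copyBlock {n : ℕ} (A : Relations n) (k : ℕ) (B : Fin n → Fin n → Prop) (s : State)
    (hr : RegsHold n 0 s) (hm : MemHolds A s) (hB : AuxHolds B 0 s) :
    Reaches (.copyBlock k) s (((4 * k + 8 + 3) * n + 6) * n + 3) fun s' => RegsHold n 0 s' ∧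
      MemHolds (Function.update A k B) s' ∧ ∀ j, s'.reg (8 + 4 * j) = s.reg (8 + 4 * j) := by
  -- The entries with index at least `m` have been copied, the others are still old.
  let J : ℕ → State → Prop := fun m s' => Keeps 0 s s' ∧ AuxHolds B 0 s' ∧
    MemHolds (Function.update A k fun x y =>
      if m ≤ n * x.val + y.val then B x y else A k x y) s'
  refine (Reaches.forVar_forVar (n := n) J ?_ ?_ ?_ hr).mono le_rfl ?_
  · rintro x y s₁ hx hy ⟨hk₁, hB₁, hm₁⟩ hr₁
    have r1 := hr₁.runs_address 1 0 1
    have hr₂ := hr₁.setReg (r := 4) (n * n * 1 + (n * x + y)) (by omega)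
    have hr₃ := hr₂.setReg (r := 2) (s₁.mem (n * n * 1 + (n * x + y))) (by omega)
    have r2 := Runs.load (s₁.setReg 4 (n * n * 1 + (n * x + y))) 2 4
    have r3 := hr₃.runs_address (2 * k) 0 1
    simp only [State.reg_setReg_self, State.mem_setReg] at r2
    simp only [Function.update_self, ne_eq, zero_ne_one, not_false_eq_true,
      Function.update_of_ne] at r1 r3
    refine (Runs.seq r1 (.seq r2 (.seq r3 (.store _ 4 2)))).reaches (by omega) ⟨⟨?_, ?_, ?_⟩, ?_⟩
    · exact ((hk₁.setReg _ (by omega)).setReg _ (by omega)).setReg _ (by omega)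
    · intro x' y' _
      rw [State.reg_setReg_self]
      simp only [State.setMem, State.mem_setReg]
      rw [Function.update_of_ne]
      · exact hB₁ x' y' (Nat.zero_le _)
      · intro h
        have := (address_inj (x := x') (y := y') (x' := ⟨x, hx⟩) (y' := ⟨y, hy⟩) h).1
        omega
    · intro k' x' y'
      rw [State.reg_setReg_self, State.reg_setReg_of_ne _ _ (by omega), State.reg_setReg_self]
      simp only [State.setMem, State.mem_setReg]
      by_cases h : k' = k ∧ x' = ⟨x, hx⟩ ∧ y' = ⟨y, hy⟩
      · obtain ⟨rfl, rfl, rfl⟩ := h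
        rw [Function.update_self]
        refine (hB₁ ⟨x, hx⟩ ⟨y, hy⟩ (Nat.zero_le _)).trans ?_
        congr 1
        simp
      · rw [Function.update_of_ne]
        · rw [hm₁]
          congr 1
          by_cases hk : k' = k
          · subst hk
            simp only [Function.update_self]
            have : n * x'.val + y'.val ≠ n * x + y := fun h' => h ⟨rfl,
              mul_add_inj (x' := ⟨x, hx⟩) (y' := ⟨y, hy⟩) h'⟩
            by_cases hle : n * x + y ≤ n * x'.val + y'.val
            · rw [if_pos hle, if_pos (by omega)]
            · rw [if_neg hle, if_neg (by omega)]
          · simp only [Function.update_of_ne hk]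
        · intro h'
          have := address_inj (x := x') (y := y') (x' := ⟨x, hx⟩) (y' := ⟨y, hy⟩) h'
          exact h ⟨by omega, this.2⟩
    · exact (hr₃.setReg _ (by omega)).setMem _ _
  · rintro i s₁ r x hr ⟨h1, h2, h3⟩
    exact ⟨h1.setReg _ (.inr (.inr (.inr hr))), h2, h3⟩
  · refine ⟨Keeps.refl 0 s, hB, ?_⟩
    convert hm using 1
    rw [Function.update_eq_self_iff]
    funext x y
    rw [if_neg]
    have h1 := x.2
    have h2 := y.2
    have : n * x.val + n ≤ n * n := by
      rw [← Nat.mul_succ]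
      exact Nat.mul_le_mul_left n h1
    omega
  · rintro s' ⟨⟨hk, -, hm⟩, hr⟩
    refine ⟨hr, ?_, hk.2⟩
    simpa using hm

/-- The formula of an assignment may read the relation that it redefines. The new values are
therefore collected in the auxiliary block and copied only when all are known. Loop counters below
`d` belong to enclosing iterations and must survive. -/
theorem Command.reaches_compile (c : Command) : ∃ p : Polynomial ℕ, ∀ (n : ℕ) [NeZero n]
    (A : Relations n) (d : ℕ) (s : State), RegsHold n 0 s → MemHolds A s →
    Reaches (c.compile d) s (p.eval n) fun s' => RegsHold n 0 s' ∧ MemHolds (c.eval A) s' ∧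
      ∀ j < d, s'.reg (8 + 4 * j) = s.reg (8 + 4 * j) := by
  induction c with
  | assign k φ =>
    obtain ⟨p, hp⟩ := φ.reaches_compile
    refine ⟨((p + Polynomial.C 8) * Polynomial.X + Polynomial.C 6) * Polynomial.X + Polynomial.C 3 +
      (((Polynomial.C (4 * k + 8 + 3)) * Polynomial.X + Polynomial.C 6) * Polynomial.X +
        Polynomial.C 3), ?_⟩
    intro n _ A d s hr hm
    simp only [Polynomial.eval_add, Polynomial.eval_mul, Polynomial.eval_C, Polynomial.eval_X]
    let B : Fin n → Fin n → Prop := fun x y =>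
      φ.eval A 2 (Function.update (Function.update (fun _ => 0) 0 x) 1 y)
    let J : ℕ → State → Prop := fun m s' => Keeps 0 s s' ∧ MemHolds A s' ∧ AuxHolds B m s'
    refine (Reaches.forVar_forVar (n := n) (T := p.eval n + 5) J ?_ ?_ ?_ hr).seq ?_
    · rintro x y s₁ hx hy ⟨hk₁, hm₁, hB₁⟩ hr₁
      let e : ℕ → Fin n := Function.update (Function.update (fun _ => 0) 0 ⟨x, hx⟩) 1 ⟨y, hy⟩
      have hupd : (fun j => (e j : ℕ)) =
          Function.update (Function.update (0 : ℕ → ℕ) 0 x) 1 y := by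
        rw [coe_update, coe_update]
        rfl
      rw [← hupd] at hr₁
      obtain ⟨t, s₂, ht, hle, hm₂, hr₂, hk₂, h2⟩ := hp n A 2 e s₁ (fun j hj => by
        simp only [e]
        rw [Function.update_of_ne (by omega), Function.update_of_ne (by omega)]; rfl) hr₁ hm₁
      have he0 : (e 0 : ℕ) = x := rfl
      have he1 : (e 1 : ℕ) = y := rfl
      have hr₃ := hr₂.setReg (r := 4) (n * n * 1 + (n * x + y)) (by omega)
      have r2 := hr₂.runs_address 1 0 1
      rw [he0, he1] at r2
      refine (Runs.seq ht (.seq r2 (.store _ 4 2))).reaches (by omega) ⟨⟨?_, ?_, ?_⟩, ?_⟩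
      · exact (hk₁.trans (hk₂.mono (Nat.zero_le _))).setReg _ (by omega)
      · intro k' x' y'
        rw [State.reg_setReg_self]
        simp only [State.setMem, State.mem_setReg]
        rw [Function.update_of_ne, hm₂]
        · exact hm₁ k' x' y'
        · intro h'
          have := (address_inj (x := x') (y := y') (x' := ⟨x, hx⟩) (y' := ⟨y, hy⟩) h').1
          omega
      · intro x' y' hle'
        rw [State.reg_setReg_self, State.reg_setReg_of_ne _ _ (by omega), h2]
        simp only [State.setMem, State.mem_setReg]
        by_cases h : x' = ⟨x, hx⟩ ∧ y' = ⟨y, hy⟩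
        · obtain ⟨rfl, rfl⟩ := h
          rw [Function.update_self]
        · have hne : n * x'.val + y'.val ≠ n * x + y := fun h' =>
            h (mul_add_inj (x' := ⟨x, hx⟩) (y' := ⟨y, hy⟩) h')
          rw [Function.update_of_ne (by omega), hm₂]
          exact hB₁ x' y' (by omega)
      · rw [hupd] at hr₃
        exact hr₃.setMem _ _
    · rintro i s₁ r x hr ⟨h1, h2, h3⟩
      exact ⟨h1.setReg _ (.inr (.inr (.inr hr))), h2, h3⟩
    · refine ⟨Keeps.refl 0 s, hm, ?_⟩
      intro x y h
      have h1 := x.2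
      have h2 := y.2
      have : n * x.val + n ≤ n * n := by
        rw [← Nat.mul_succ]
        exact Nat.mul_le_mul_left n h1
      omega
    · rintro s₁ ⟨⟨hk₁, hm₁, hB₁⟩, hr₁⟩
      refine (reaches_copyBlock A k B s₁ hr₁ hm₁ hB₁).mono le_rfl ?_
      rintro s₂ ⟨hr₂, hm₂, hc⟩
      exact ⟨hr₂, hm₂, fun j _ => (hc j).trans (hk₁.2 j)⟩
  | seq c c' ih ih' =>
    obtain ⟨p, hp⟩ := ih
    obtain ⟨q, hq⟩ := ih'
    refine ⟨p + q, ?_⟩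
    intro n _ A d s hr hm
    rw [Polynomial.eval_add]
    refine (hp n A d s hr hm).seq ?_
    rintro s₁ ⟨hr₁, hm₁, hc₁⟩
    refine (hq n _ d s₁ hr₁ hm₁).mono le_rfl ?_
    rintro s₂ ⟨hr₂, hm₂, hc₂⟩
    exact ⟨hr₂, hm₂, fun j hj => (hc₂ j hj).trans (hc₁ j hj)⟩
  | iter c ih =>
    obtain ⟨p, hp⟩ := ih
    refine ⟨(p + Polynomial.C 2) * Polynomial.X + Polynomial.C 2, ?_⟩
    intro n _ A d s hr hm
    simp only [Polynomial.eval_add, Polynomial.eval_mul, Polynomial.eval_C, Polynomial.eval_X]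
    -- With `i` rounds left, `n - i` rounds have been executed.
    have key := Reaches.while (r := 8 + 4 * d)
      (P := .seq (.sub (8 + 4 * d) (8 + 4 * d) 1) (c.compile (d + 1))) (T := p.eval n + 1)
      (fun i s' => i ≤ n ∧ s'.reg (8 + 4 * d) = i ∧ RegsHold n 0 s' ∧
        MemHolds (c.eval^[n - i] A) s' ∧ ∀ j < d, s'.reg (8 + 4 * j) = s.reg (8 + 4 * j))
      (fun i s hs => hs.2.1) ?_ n (s.setReg (8 + 4 * d) n) ?_
    · obtain ⟨t, s', ht, hle, -, -, hr', hm', hc'⟩ := key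
      have r1 := Runs.copy s (8 + 4 * d) 0
      rw [hr.dim] at r1
      rw [show p.eval n + 1 + 1 = p.eval n + 2 from rfl] at hle
      rw [Nat.sub_zero] at hm'
      exact ⟨_, s', .seq r1 ht, by omega, hr', hm', hc'⟩
    · rintro i s₁ ⟨hi, hd, hr₁, hm₁, hc₁⟩
      have r1 := Runs.sub s₁ (8 + 4 * d) (8 + 4 * d) 1
      rw [hd, hr₁.one, Nat.add_sub_cancel] at r1
      obtain ⟨t, s₂, ht, hle, hr₂, hm₂, hc₂⟩ := hp n _ (d + 1) (s₁.setReg (8 + 4 * d) i)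
        (hr₁.setReg _ (.inr (.inr ⟨d, .inr rfl⟩))) hm₁
      refine ⟨_, s₂, .seq r1 ht, by omega, by omega, ?_, hr₂, ?_, ?_⟩
      · rw [hc₂ d (by omega), State.reg_setReg_self]
      · rwa [← Function.iterate_succ_apply' c.eval, ← Nat.succ_sub hi, Nat.succ_sub_succ] at hm₂
      · intro j hj
        rw [hc₂ j (by omega), State.reg_setReg_of_ne _ _ (by omega), hc₁ j hj]
    · refine ⟨le_rfl, State.reg_setReg_self _ _ _, hr.setReg _ (.inr (.inr ⟨d, .inr rfl⟩)), ?_, ?_⟩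
      · rw [Nat.sub_self]
        exact hm
      · intro j hj
        rw [State.reg_setReg_of_ne _ _ (by omega)]

end RAM

/-! ### Elimination of simplicial vertices -/

/-- A partial elimination of the vertices of `D`. The vertices in `Dead` are eliminated; those in
`Sel` have been selected as simplicial vertices, and `Later x y` says that `y` was still present
after the elimination of the selected vertex `x`. -/
structure Digraph.Elimination {V : Type*} (D : Digraph V) (G : SimpleGraph V)
    (Sel Dead : V → Prop) (Later : V → V → Prop) : Prop where
  sel_dead {x : V} : Sel x → Dead x
  later_sel {x y : V} : Later x y → Sel x
  later_of_sel {x y : V} : Sel x → ¬ Dead y → Later x y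
  total {x y : V} : Sel x → Sel y → x ≠ y → Later x y ∨ Later y x
  irrefl (x : V) : ¬ Later x x
  trans {x y z : V} : Later x y → Later y z → Later x z
  arc {x y : V} : Later x y → G.Adj x y → D.Adj x y
  absorbed {u : V} : Dead u →
    Sel u ∨ ∃ v, Sel v ∧ D.Adj u v ∧ ∀ y, Later v y → G.Adj v y → D.Adj u y

theorem Digraph.elimination_empty {V : Type*} (D : Digraph V) (G : SimpleGraph V) :
    D.Elimination G (fun _ => False) (fun _ => False) (fun _ _ => False) := by
  constructor <;> simp

/-- The closed neighbourhood of `v` among the vertices that are not in `Dead`. -/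
def SimpleGraph.closedNbhd {V : Type*} (G : SimpleGraph V) (Dead : V → Prop) (v : V) : Set V :=
  {x | ¬ Dead x ∧ (x = v ∨ G.Adj x v)}

/-- `M` consists of `v` and of the vertices of its closed neighbourhood from which there is a path
of one-way arcs to `v`. -/
structure Digraph.IsEliminationSet {V : Type*} (D : Digraph V) (G : SimpleGraph V)
    (Dead : V → Prop) (v : V) (M : V → Prop) : Prop where
  self : M v
  mem {x : V} : M x → x ∈ G.closedNbhd Dead v
  path {x : V} : M x → Relation.ReflTransGen
    (fun a b => D.OneWay a b ∧ a ∈ G.closedNbhd Dead v ∧ b ∈ G.closedNbhd Dead v) x v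
  closed {x y : V} : x ∈ G.closedNbhd Dead v → M y → D.OneWay x y → M x

/-- The closed neighbourhood of `v` is a clique because `v` is simplicial. Arcs to survivors come
from the closedness of `M`, arcs from `M` to `v` from clique-acyclicity along the paths in `M`. -/
theorem Digraph.Elimination.extend {V : Type*} [Finite V] {D : Digraph V} {G : SimpleGraph V}
    {Sel Dead : V → Prop} {Later : V → V → Prop} (h : D.Elimination G Sel Dead Later)
    (hDG : D.IsSuperOrientation G) (hD : D.IsCliqueAcyclic G) {v : V} (hv : ¬ Dead v)
    (hs : G.IsSimplicialIn {x | ¬ Dead x} v) {M : V → Prop}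
    (hM : D.IsEliminationSet G Dead v M) :
    D.Elimination G (fun x => Sel x ∨ x = v) (fun x => Dead x ∨ M x)
      (fun x y => Later x y ∨ (x = v ∧ ¬ (Dead y ∨ M y))) := by
  have hvS : ¬ Sel v := fun hS => hv (h.sel_dead hS)
  have hvC : v ∈ G.closedNbhd Dead v := ⟨hv, Or.inl rfl⟩
  have hC : G.IsClique (G.closedNbhd Dead v) := by
    rintro a ⟨ha, rfl | ha'⟩ b ⟨hb, rfl | hb'⟩ hab
    · exact absurd rfl hab
    · exact hb'.symm
    · exact ha'
    · exact hs a ha b hb ha'.symm hb'.symm hab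
  have harc : ∀ {a b}, G.Adj a b → ¬ D.OneWay b a → D.Adj a b := by
    intro a b hab hba
    rcases (hDG a b).1 hab with h1 | h1
    · exact h1
    · by_contra h2
      exact hba ⟨h1, h2⟩
  constructor
  · rintro x (hx | rfl)
    · exact Or.inl (h.sel_dead hx)
    · exact Or.inr hM.self
  · rintro x y (hx | ⟨rfl, -⟩)
    · exact Or.inl (h.later_sel hx)
    · exact Or.inr rfl
  · rintro x y (hx | rfl) hy
    · exact Or.inl (h.later_of_sel hx fun hy' => hy (Or.inl hy'))
    · exact Or.inr ⟨rfl, hy⟩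
  · rintro x y (hx | rfl) (hy | rfl) hxy
    · exact (h.total hx hy hxy).imp Or.inl Or.inl
    · exact Or.inl (Or.inl (h.later_of_sel hx hv))
    · exact Or.inr (Or.inl (h.later_of_sel hy hv))
    · exact absurd rfl hxy
  · rintro x (hx | ⟨rfl, hx⟩)
    · exact h.irrefl x hx
    · exact hx (Or.inr hM.self)
  · rintro x y z (hxy | ⟨rfl, hy⟩) (hyz | ⟨rfl, hz⟩)
    · exact Or.inl (h.trans hxy hyz)
    · exact Or.inl (h.later_of_sel (h.later_sel hxy) fun hz' => hz (Or.inl hz'))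
    · exact absurd (Or.inl (h.sel_dead (h.later_sel hyz))) hy
    · exact absurd (Or.inr hM.self) hy
  · rintro x y (hxy | ⟨rfl, hy⟩) hadj
    · exact h.arc hxy hadj
    · refine harc hadj fun hyx => hy (Or.inr (hM.closed ⟨?_, Or.inr hadj.symm⟩ hM.self hyx))
      exact fun hy' => hy (Or.inl hy')
  · rintro u (hu | hu)
    · rcases h.absorbed hu with hu | ⟨w, hw, huw, hwy⟩
      · exact Or.inl (Or.inl hu)
      -- The new pairs in `Later` all start at `v`, so an old absorber `w` acquires none.
      · refine Or.inr ⟨w, Or.inl hw, huw, ?_⟩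
        rintro y (hy | ⟨rfl, -⟩) hadj
        · exact hwy y hy hadj
        · exact absurd hw hvS
    · obtain ⟨huD, rfl | huv⟩ := hM.mem hu
      · exact Or.inl (Or.inr rfl)
      · refine Or.inr ⟨v, Or.inr rfl, harc huv
          (hD.not_oneWay_of_reflTransGen hC (hM.mem hu) hvC (hM.path hu)), ?_⟩
        rintro y (hy | ⟨-, hy⟩) hadj
        · exact absurd (h.later_sel hy) hvS
        · have hyC : y ∈ G.closedNbhd Dead v := ⟨fun hy' => hy (Or.inl hy'), Or.inr hadj.symm⟩
          have huy : u ≠ y := by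
            rintro rfl
            exact hy (Or.inr hu)
          exact harc (hC (hM.mem hu) hyC huy) fun hyu => hy (Or.inr (hM.closed hyC hu hyu))

/-- If a selected vertex is not in `K`, the recursion gives it a later neighbour in `K`. Both the
vertex itself (`arc`) and the vertices that it absorbs (`absorbed`) have an arc to that neighbour.
-/
theorem Digraph.Elimination.isKernel {V : Type*} {D : Digraph V} {G : SimpleGraph V}
    {Sel Dead : V → Prop} {Later : V → V → Prop} (h : D.Elimination G Sel Dead Later)
    (hDG : D.IsSuperOrientation G) (hall : ∀ x, Dead x) {K : V → Prop}
    (hK : ∀ x, K x ↔ Sel x ∧ ¬ ∃ y, Later x y ∧ G.Adj x y ∧ K y) : D.IsKernel {x | K x} := by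
  constructor
  · intro u hu v hv huv
    have hadj : G.Adj u v := (hDG u v).2 (Or.inl huv)
    have hu' := (hK u).1 hu
    have hv' := (hK v).1 hv
    rcases h.total hu'.1 hv'.1 hadj.ne with h1 | h1
    · exact hu'.2 ⟨v, h1, hadj, hv⟩
    · exact hv'.2 ⟨u, h1, hadj.symm, hu⟩
  · intro u hu
    rcases h.absorbed (hall u) with hs | ⟨v, hv, huv, hy⟩
    · by_contra! hcon
      refine hu ((hK u).2 ⟨hs, ?_⟩)
      rintro ⟨y, h1, h2, h3⟩
      exact hcon y h3 (h.arc h1 h2)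
    · by_cases hvK : K v
      · exact ⟨v, hvK, huv⟩
      · by_contra! hcon
        refine hvK ((hK v).2 ⟨hv, ?_⟩)
        rintro ⟨y, h1, h2, h3⟩
        exact hcon y h3 (hy y h1 h2)

/-! ### The algorithm -/

namespace RAM

/-- Disjunction. -/
def Formula.or (φ ψ : Formula) : Formula := .neg (.and (.neg φ) (.neg ψ))

/-- The variables `i` and `j` are adjacent; relation `0` is the given digraph. -/
def Formula.adj (i j : ℕ) : Formula := .or (.rel 0 i j) (.rel 0 j i)

theorem Formula.eval_or {n : ℕ} (A : Relations n) (φ ψ : Formula) (d : ℕ) (e : ℕ → Fin n) :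
    (φ.or ψ).eval A d e ↔ φ.eval A d e ∨ ψ.eval A d e := by
  simp only [Formula.or, Formula.eval]
  tauto

theorem Formula.eval_adj {n : ℕ} (A : Relations n) (i j d : ℕ) (e : ℕ → Fin n) :
    (Formula.adj i j).eval A d e ↔ A 0 (e i) (e j) ∨ A 0 (e j) (e i) := by
  rw [Formula.adj, Formula.eval_or]
  rfl

/-- Relation `1` singles out the first simplicial vertex, relation `5` being the set of eliminated
vertices. -/
def Command.select : Command :=
  .seq
    (.assign 7 (.and (.neg (.rel 5 0 0)) (.neg (.ex (.ex (.and (.neg (.rel 5 2 2))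
      (.and (.neg (.rel 5 3 3)) (.and (.adj 0 2) (.and (.adj 0 3)
        (.and (.lt 2 3) (.neg (.adj 2 3))))))))))))
    (.assign 1 (.and (.rel 7 0 0) (.neg (.ex (.and (.lt 2 0) (.rel 7 2 2))))))

/-- Add to relation `2` the vertices with a one-way arc into it that are adjacent to the selected
vertex. -/
def Command.grow : Command :=
  .assign 2 (.or (.rel 2 0 0) (.and (.neg (.rel 5 0 0)) (.and
    (.ex (.and (.rel 2 2 2) (.and (.rel 0 0 2) (.neg (.rel 0 2 0)))))
    (.ex (.and (.rel 1 2 2) (.adj 0 2))))))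

/-- Record the selected vertex in relation `3` and the elimination in relations `5` and `4`. -/
def Command.record : Command :=
  .seq (.assign 3 (.or (.rel 3 0 0) (.rel 1 0 0)))
    (.seq (.assign 5 (.or (.rel 5 0 0) (.rel 2 0 0)))
      (.assign 4 (.or (.rel 4 0 1) (.and (.rel 1 0 0) (.neg (.rel 5 1 1))))))

/-- One elimination step. -/
def Command.eliminate : Command :=
  .seq .select (.seq (.assign 2 (.rel 1 0 0)) (.seq (.iter .grow) .record))

/-- Relation `6` becomes the set of the selected vertices without a later neighbour in it. -/
def Command.choose : Command :=
  .assign 6 (.and (.rel 3 0 0) (.neg (.ex (.and (.rel 4 0 2) (.and (.adj 0 2) (.rel 6 2 2))))))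

/-- The computation of a kernel, which is written into each row of relation `0`. -/
def Command.kernel : Command :=
  .seq (.iter .eliminate) (.seq (.iter .choose) (.assign 0 (.rel 6 1 1)))

theorem iterate_induction {α : Type*} (f : α → α) (I : ℕ → α → Prop) {a : α} (h0 : I 0 a)
    (hs : ∀ i a, I i a → I (i + 1) (f a)) (m : ℕ) : I m (f^[m] a) := by
  induction m with
  | zero => exact h0
  | succ m ih =>
    rw [Function.iterate_succ_apply']
    exact hs _ _ ih

/-! ### The relations defined by the commands. -/

section Semantics

variable {n : ℕ} [NeZero n] (A : Relations n)

/-- The vertex `x` is present and simplicial. -/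
def Candidate (x : Fin n) : Prop :=
  ¬ A 5 x x ∧ ¬ ∃ p q, ¬ A 5 p p ∧ ¬ A 5 q q ∧ (A 0 x p ∨ A 0 p x) ∧ (A 0 x q ∨ A 0 q x) ∧
    p < q ∧ ¬ (A 0 p q ∨ A 0 q p)

/-- Sets of vertices are coded by the diagonals of relations; their defining formulas ignore
variable `1`. -/
theorem Command.eval_select : Command.select.eval A =
    Function.update (Function.update A 7 fun x _ => Candidate A x) 1
      fun x _ => Candidate A x ∧ ¬ ∃ y, y < x ∧ Candidate A y := by
  simp [Command.select, Command.eval, Formula.eval, Formula.eval_adj, Candidate]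

theorem Command.eval_grow : Command.grow.eval A = Function.update A 2 fun x _ =>
    A 2 x x ∨ (¬ A 5 x x ∧ (∃ y, A 2 y y ∧ A 0 x y ∧ ¬ A 0 y x) ∧
      ∃ z, A 1 z z ∧ (A 0 x z ∨ A 0 z x)) := by
  simp [Command.grow, Command.eval, Formula.eval, Formula.eval_adj, Formula.eval_or]

theorem Command.eval_record : Command.record.eval A =
    Function.update (Function.update (Function.update A 3 fun x _ => A 3 x x ∨ A 1 x x) 5
      fun x _ => A 5 x x ∨ A 2 x x) 4
      fun x y => A 4 x y ∨ (A 1 x x ∧ ¬ (A 5 y y ∨ A 2 y y)) := by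
  simp [Command.record, Command.eval, Formula.eval, Formula.eval_or]

theorem Command.eval_choose : Command.choose.eval A = Function.update A 6 fun x _ =>
    A 3 x x ∧ ¬ ∃ y, A 4 x y ∧ (A 0 x y ∨ A 0 y x) ∧ A 6 y y := by
  simp [Command.choose, Command.eval, Formula.eval, Formula.eval_adj]

end Semantics

/-! ### Correctness of the elimination and of the backward choice. -/

section Correctness

variable {n : ℕ} {D : Digraph (Fin n)} {G : SimpleGraph (Fin n)} {A : Relations n}

open Classical in
theorem card_lt_of_not_iff {P Q : Fin n → Prop} (h : ∀ x, P x → Q x) {x : Fin n} (hP : ¬ P x)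
    (hQ : Q x) : (Finset.univ.filter P).card < (Finset.univ.filter Q).card := by
  refine Finset.card_lt_card ((Finset.ssubset_iff_of_subset ?_).2 ⟨x, by simpa, by simpa⟩)
  intro y hy
  simpa using h y (by simpa using hy)

open Classical in
theorem forall_of_le_card {P : Fin n → Prop} (h : n ≤ (Finset.univ.filter P).card) (x : Fin n) :
    P x := by
  by_contra hx
  have := card_lt_of_not_iff (P := P) (Q := fun _ => True) (fun _ _ => trivial) hx trivial
  simp at this
  omega

/-- Since adjacency is symmetric, `p < q` may replace `p ≠ q`. -/
theorem candidate_iff (hDG : D.IsSuperOrientation G) (h0 : A 0 = D.Adj) (x : Fin n) :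
    Candidate A x ↔ ¬ A 5 x x ∧ G.IsSimplicialIn {y | ¬ A 5 y y} x := by
  simp only [Candidate, h0, ← hDG _ _]
  refine and_congr_right fun _ => ⟨?_, ?_⟩
  · intro h a ha b hb hxa hxb hab
    by_contra hadj
    rcases lt_or_gt_of_ne hab with hlt | hlt
    · exact h ⟨a, b, ha, hb, hxa, hxb, hlt, hadj⟩
    · exact h ⟨b, a, hb, ha, hxb, hxa, hlt, fun h' => hadj h'.symm⟩
  · rintro h ⟨a, b, ha, hb, hxa, hxb, hlt, hadj⟩
    exact hadj (h a ha b hb hxa hxb hlt.ne)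

variable [NeZero n]

theorem iterate_grow_of_empty (h2 : ∀ x, ¬ A 2 x x) :
    (∀ k, k ≠ 2 → Command.grow.eval^[n] A k = A k) ∧
      ∀ x, ¬ Command.grow.eval^[n] A 2 x x := by
  refine iterate_induction _ (fun _ (B : Relations n) => (∀ k, k ≠ 2 → B k = A k) ∧ ∀ x, ¬ B 2 x x)
    ⟨fun _ _ => rfl, h2⟩ ?_ n
  rintro _ B ⟨hB, hB2⟩
  rw [Command.eval_grow]
  refine ⟨fun k hk => by rw [Function.update_of_ne hk, hB k hk], fun x hx => ?_⟩
  rw [Function.update_self] at hx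
  rcases hx with hx | ⟨-, ⟨y, hy, -⟩, -⟩
  · exact hB2 x hx
  · exact hB2 y hy

open Classical in
theorem iterate_grow (hDG : D.IsSuperOrientation G) (h0 : A 0 = D.Adj) {v : Fin n}
    (hv : ¬ A 5 v v) (h1 : ∀ x, A 1 x x ↔ x = v) (h2 : ∀ x, A 2 x x ↔ x = v) :
    (∀ k, k ≠ 2 → Command.grow.eval^[n] A k = A k) ∧
      D.IsEliminationSet G (fun x => A 5 x x) v fun x => Command.grow.eval^[n] A 2 x x := by
  let C := G.closedNbhd (fun x => A 5 x x) v
  let r : Fin n → Fin n → Prop := fun a b => D.OneWay a b ∧ a ∈ C ∧ b ∈ C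
  have hvC : v ∈ C := ⟨hv, Or.inl rfl⟩
  -- After `i` rounds the set is closed or has at least `i` elements; after `n` rounds the second
  -- case means all vertices, and closedness is trivial.
  have key := iterate_induction Command.grow.eval (fun i B => (∀ k, k ≠ 2 → B k = A k) ∧
    B 2 v v ∧ (∀ x, B 2 x x → x ∈ C ∧ Relation.ReflTransGen r x v) ∧
    ((∀ x y, x ∈ C → B 2 y y → D.OneWay x y → B 2 x x) ∨
      i ≤ (Finset.univ.filter fun x => B 2 x x).card)) (a := A) ?_ ?_ n
  · obtain ⟨hk, hself, hmem, hclosed⟩ := key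
    refine ⟨hk, hself, fun hx => (hmem _ hx).1, fun hx => (hmem _ hx).2, fun hx hy hxy => ?_⟩
    rcases hclosed with hc | hc
    · exact hc _ _ hx hy hxy
    · exact forall_of_le_card hc _
  · refine ⟨fun _ _ => rfl, (h2 v).2 rfl, fun x hx => ?_, Or.inr (Nat.zero_le _)⟩
    obtain rfl := (h2 x).1 hx
    exact ⟨hvC, .refl⟩
  · rintro i B ⟨hk, hself, hmem, hclosed⟩
    have hgrow : ∀ x, Command.grow.eval B 2 x x ↔
        B 2 x x ∨ (¬ A 5 x x ∧ (∃ y, B 2 y y ∧ D.OneWay x y) ∧ G.Adj x v) := by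
      intro x
      rw [Command.eval_grow, Function.update_self, hk 0 (by omega), hk 1 (by omega),
        hk 5 (by omega), h0]
      simp only [h1, exists_eq_left, ← hDG x v]
      rfl
    have hstep : ∀ x, Command.grow.eval B 2 x x ↔
        B 2 x x ∨ (x ∈ C ∧ ∃ y, B 2 y y ∧ D.OneWay x y) := by
      intro x
      rw [hgrow]
      constructor
      · rintro (h | ⟨h, h', h''⟩)
        · exact Or.inl h
        · exact Or.inr ⟨⟨h, Or.inr h''⟩, h'⟩
      · rintro (h | ⟨⟨h, rfl | h'⟩, h''⟩)
        · exact Or.inl h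
        · exact Or.inl hself
        · exact Or.inr ⟨h, h'', h'⟩
    refine ⟨fun k hk2 => ?_, (hstep v).2 (Or.inl hself), ?_, ?_⟩
    · rw [Command.eval_grow, Function.update_of_ne hk2, hk k hk2]
    · intro x hx
      rcases (hstep x).1 hx with h | ⟨hxC, y, hy, hxy⟩
      · exact hmem x h
      · exact ⟨hxC, (hmem y hy).2.head ⟨hxy, hxC, (hmem y hy).1⟩⟩
    · by_cases hc : ∀ x y, x ∈ C → B 2 y y → D.OneWay x y → B 2 x x
      · left
        have hsame : ∀ x, Command.grow.eval B 2 x x ↔ B 2 x x := fun x =>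
          (hstep x).trans ⟨fun h => h.elim id fun ⟨hx, y, hy, hxy⟩ => hc x y hx hy hxy, Or.inl⟩
        intro x y hx hy hxy
        exact (hsame x).2 (hc x y hx ((hsame y).1 hy) hxy)
      · right
        have hcard := hclosed.resolve_left hc
        push Not at hc
        obtain ⟨x, y, hx, hy, hxy, hxB⟩ := hc
        have := card_lt_of_not_iff (P := fun x => B 2 x x)
          (Q := fun x => Command.grow.eval B 2 x x) (fun x hx => (hstep x).2 (Or.inl hx)) hxB
          ((hstep x).2 (Or.inr ⟨hx, y, hy, hxy⟩))
        omega

open Classical in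
/-- The relations describe a partial elimination of at least `i` vertices, or of all of them. -/
structure Eliminated (D : Digraph (Fin n)) (G : SimpleGraph (Fin n)) (i : ℕ) (A : Relations n) :
    Prop where
  input : A 0 = D.Adj
  elimination : D.Elimination G (fun x => A 3 x x) (fun x => A 5 x x) (A 4)
  progress : (∀ x, A 5 x x) ∨ i ≤ (Finset.univ.filter fun x => A 5 x x).card

/-- Rounds after the elimination is complete find no candidate and change nothing that matters. -/
theorem eliminate_eval_of_forall_dead (h : ∀ x, A 5 x x) :
    Command.eliminate.eval A 0 = A 0 ∧
      (∀ x, Command.eliminate.eval A 3 x x ↔ A 3 x x) ∧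
      (∀ x, Command.eliminate.eval A 5 x x) ∧
      ∀ x y, Command.eliminate.eval A 4 x y ↔ A 4 x y := by
  set B := (Command.assign 2 (.rel 1 0 0)).eval (Command.select.eval A) with hB
  have hB1 : ∀ x, ¬ B 1 x x := by
    intro x
    simp [hB, Command.eval, Command.eval_select, Candidate, h]
  have hB2 : ∀ x, ¬ B 2 x x := by
    intro x
    simp [hB, Command.eval, Command.eval_select, Candidate, h, Formula.eval]
  have hBk : ∀ k, k ≠ 1 → k ≠ 2 → k ≠ 7 → B k = A k := by
    intro k hk1 hk2 hk7
    simp [hB, Command.eval, Command.eval_select, Function.update_of_ne, hk1, hk2, hk7]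
  obtain ⟨hk, hM⟩ := iterate_grow_of_empty hB2
  have heval : Command.eliminate.eval A = Command.record.eval (Command.grow.eval^[n] B) := rfl
  rw [heval, Command.eval_record]
  simp [hk, hM, hBk, hB1, h]

theorem exists_eliminate_eval (hG : G.IsChordalGraph) (hDG : D.IsSuperOrientation G)
    (h0 : A 0 = D.Adj) (h : ∃ x, ¬ A 5 x x) :
    ∃ (v : Fin n) (M : Fin n → Prop), ¬ A 5 v v ∧ G.IsSimplicialIn {x | ¬ A 5 x x} v ∧
      D.IsEliminationSet G (fun x => A 5 x x) v M ∧
      Command.eliminate.eval A 0 = A 0 ∧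
      (∀ x, Command.eliminate.eval A 3 x x ↔ A 3 x x ∨ x = v) ∧
      (∀ x, Command.eliminate.eval A 5 x x ↔ A 5 x x ∨ M x) ∧
      ∀ x y, Command.eliminate.eval A 4 x y ↔ A 4 x y ∨ (x = v ∧ ¬ (A 5 y y ∨ M y)) := by
  classical
  have hex : ∃ x, Candidate A x := by
    obtain ⟨v, hv, hs⟩ := hG.exists_isSimplicialIn (U := {x | ¬ A 5 x x}) h
    exact ⟨v, (candidate_iff hDG h0 v).2 ⟨hv, hs⟩⟩
  obtain ⟨v, hv, hmin⟩ := WellFounded.has_min (wellFounded_lt (α := Fin n))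
    {x | Candidate A x} hex
  have hsel : ∀ x, (Candidate A x ∧ ¬ ∃ y, y < x ∧ Candidate A y) ↔ x = v := by
    intro x
    constructor
    · rintro ⟨hx, hx'⟩
      rcases lt_trichotomy x v with hlt | rfl | hlt
      · exact absurd hlt (hmin x hx)
      · rfl
      · exact absurd ⟨v, hlt, hv⟩ hx'
    · rintro rfl
      exact ⟨hv, fun ⟨y, hy, hy'⟩ => hmin y hy' hy⟩
  obtain ⟨hvD, hvs⟩ := (candidate_iff hDG h0 v).1 hv
  set B := (Command.assign 2 (.rel 1 0 0)).eval (Command.select.eval A) with hB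
  have hB1 : ∀ x, B 1 x x ↔ x = v := by
    intro x
    rw [← hsel x]
    simp [hB, Command.eval, Command.eval_select]
  have hB2 : ∀ x, B 2 x x ↔ x = v := by
    intro x
    rw [← hsel x]
    simp [hB, Command.eval, Command.eval_select, Formula.eval]
  have hBk : ∀ k, k ≠ 1 → k ≠ 2 → k ≠ 7 → B k = A k := by
    intro k hk1 hk2 hk7
    simp [hB, Command.eval, Command.eval_select, Function.update_of_ne, hk1, hk2, hk7]
  have hB5 : B 5 = A 5 := hBk 5 (by omega) (by omega) (by omega)
  obtain ⟨hk, hM⟩ := iterate_grow (A := B) (v := v) hDG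
    ((hBk 0 (by omega) (by omega) (by omega)).trans h0) (by rwa [hB5]) hB1 hB2
  rw [hB5] at hM
  have heval : Command.eliminate.eval A = Command.record.eval (Command.grow.eval^[n] B) := rfl
  refine ⟨v, _, hvD, hvs, hM, ?_⟩
  rw [heval, Command.eval_record]
  simp [hk, hBk, hB1]

theorem Eliminated.eliminate (hG : G.IsChordalGraph) (hDG : D.IsSuperOrientation G)
    (hD : D.IsCliqueAcyclic G) {i : ℕ} (h : Eliminated D G i A) :
    Eliminated D G (i + 1) (Command.eliminate.eval A) := by
  classical
  by_cases hall : ∀ x, A 5 x x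
  · obtain ⟨e0, e3, e5, e4⟩ := eliminate_eval_of_forall_dead hall
    refine ⟨e0.trans h.input, ?_, Or.inl e5⟩
    have h3 : (fun x => Command.eliminate.eval A 3 x x) = fun x => A 3 x x :=
      funext fun x => propext (e3 x)
    have h5 : (fun x => Command.eliminate.eval A 5 x x) = fun x => A 5 x x :=
      funext fun x => propext ⟨fun _ => hall x, fun _ => e5 x⟩
    have h4 : Command.eliminate.eval A 4 = A 4 :=
      funext fun x => funext fun y => propext (e4 x y)
    rw [h3, h5, h4]
    exact h.elimination
  · have hcard := h.progress.resolve_left hall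
    push Not at hall
    obtain ⟨v, M, hv, hs, hM, e0, e3, e5, e4⟩ := exists_eliminate_eval hG hDG h.input hall
    refine ⟨e0.trans h.input, ?_, Or.inr ?_⟩
    · have h3 : (fun x => Command.eliminate.eval A 3 x x) = fun x => A 3 x x ∨ x = v :=
        funext fun x => propext (e3 x)
      have h5 : (fun x => Command.eliminate.eval A 5 x x) = fun x => A 5 x x ∨ M x :=
        funext fun x => propext (e5 x)
      have h4 : Command.eliminate.eval A 4 =
          fun x y => A 4 x y ∨ (x = v ∧ ¬ (A 5 y y ∨ M y)) :=
        funext fun x => funext fun y => propext (e4 x y)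
      rw [h3, h5, h4]
      exact h.elimination.extend hDG hD hv hs hM
    · have := card_lt_of_not_iff (P := fun x => A 5 x x)
        (Q := fun x => Command.eliminate.eval A 5 x x) (fun x hx => (e5 x).2 (Or.inl hx)) hv
        ((e5 v).2 (Or.inr hM.self))
      omega

/-- By transitivity and irreflexivity, the number of later vertices drops along relation `4`. After
`i` rounds the recursion holds at vertices with fewer than `i` later ones, whatever relation `6` was
initially; irreflexivity keeps these numbers below `n`. -/
theorem iterate_choose (hirr : ∀ x, ¬ A 4 x x)
    (htrans : ∀ x y z, A 4 x y → A 4 y z → A 4 x z) :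
    ∀ x, Command.choose.eval^[n] A 6 x x ↔ A 3 x x ∧ ¬ ∃ y, A 4 x y ∧ (A 0 x y ∨ A 0 y x) ∧
      Command.choose.eval^[n] A 6 y y := by
  classical
  have key := iterate_induction Command.choose.eval (fun i B => (∀ k, k ≠ 6 → B k = A k) ∧
    ∀ x, (Finset.univ.filter fun y => A 4 x y).card < i → (B 6 x x ↔ A 3 x x ∧
      ¬ ∃ y, A 4 x y ∧ (A 0 x y ∨ A 0 y x) ∧ B 6 y y)) (a := A) ?_ ?_ n
  · intro x
    refine key.2 x ?_
    have := card_lt_of_not_iff (P := fun y => A 4 x y) (Q := fun _ => True)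
      (fun _ _ => trivial) (hirr x) trivial
    simpa using this
  · exact ⟨fun _ _ => rfl, fun x hx => absurd hx (Nat.not_lt_zero _)⟩
  · rintro i B ⟨hk, hB⟩
    have hstep : ∀ x, Command.choose.eval B 6 x x ↔
        A 3 x x ∧ ¬ ∃ y, A 4 x y ∧ (A 0 x y ∨ A 0 y x) ∧ B 6 y y := by
      intro x
      rw [Command.eval_choose, Function.update_self, hk 0 (by omega), hk 3 (by omega),
        hk 4 (by omega)]
    refine ⟨fun k hk6 => ?_, fun x hx => ?_⟩
    · rw [Command.eval_choose, Function.update_of_ne hk6, hk k hk6]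
    · rw [hstep x]
      refine and_congr_right fun _ => not_congr (exists_congr fun y => and_congr_right fun hxy =>
        and_congr_right fun _ => ?_)
      have := card_lt_of_not_iff (P := fun z => A 4 y z) (Q := fun z => A 4 x z)
        (fun z hz => htrans x y z hxy hz) (hirr y) hxy
      rw [hstep y, hB y (by omega)]

theorem kernel_eval (hG : G.IsChordalGraph) (hDG : D.IsSuperOrientation G)
    (hD : D.IsCliqueAcyclic G) (h0 : A 0 = D.Adj) (h : ∀ k, k ≠ 0 → A k = fun _ _ => False) :
    ∃ K : Set (Fin n), D.IsKernel K ∧ ∀ x y, Command.kernel.eval A 0 x y ↔ y ∈ K := by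
  have hB : Eliminated D G n (Command.eliminate.eval^[n] A) := by
    refine iterate_induction _ (Eliminated D G) ?_ (fun i B hB => hB.eliminate hG hDG hD) n
    refine ⟨h0, ?_, Or.inr (Nat.zero_le _)⟩
    simpa [h] using D.elimination_empty G
  set B := Command.eliminate.eval^[n] A
  have hK := iterate_choose hB.elimination.irrefl
    fun x y z => hB.elimination.trans
  rw [hB.input] at hK
  simp only [← hDG _ _] at hK
  refine ⟨_, hB.elimination.isKernel hDG
    (fun x => hB.progress.elim (fun h' => h' x) fun h' => forall_of_le_card h' x) hK, ?_⟩
  intro x y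
  have heval : Command.kernel.eval A =
      (Command.assign 0 (.rel 6 1 1)).eval (Command.choose.eval^[n] B) := rfl
  rw [heval]
  simp [Command.eval, Formula.eval]

end Correctness

/-! ### The program -/

/-- Initialize the registers `1` and `3`. -/
def Program.setUp : Program :=
  .seq (.const 1 1) (.seq (.copy 8 0) (.whileNonzero 8 (.seq (.sub 8 8 1) (.add 3 3 0))))

/-- The program for the computation of kernels. -/
def Program.kernel : Program :=
  .seq .setUp (.ifNonzero 0 (Command.kernel.compile 0) .skip)

/-- The square is obtained by adding `n` to register `3` `n` times. -/
theorem reaches_setUp {n : ℕ} (D : Digraph (Fin n)) :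
    Reaches .setUp (inputState D) (3 * n + 3) fun s =>
      RegsHold n 0 s ∧ s.mem = (inputState D).mem := by
  have key := Reaches.while (r := 8) (P := .seq (.sub 8 8 1) (.add 3 3 0)) (T := 2)
    (fun i s => i ≤ n ∧ s.mem = (inputState D).mem ∧ s.reg 8 = i ∧ s.reg 0 = n ∧ s.reg 1 = 1 ∧
      s.reg 3 = n * (n - i) ∧ ∀ j, s.reg (5 + 4 * j) = 0 ∧ s.reg (6 + 4 * j) = 0)
    (fun i s hs => hs.2.2.1) ?_ n (((inputState D).setReg 1 1).setReg 8 n) ?_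
  · obtain ⟨t, s, ht, hle, -, hm, -, h0, h1, h3, hv⟩ := key
    refine ⟨_, s, .seq (.const _ 1 1) (.seq (.copy _ 8 0) ht), by omega, ⟨h0, h1, h3, ?_, ?_⟩, hm⟩
    · exact fun j => (hv j).1
    · exact fun j => (hv j).2
  · rintro i s ⟨hi, hm, h8, h0, h1, h3, hv⟩
    have r1 := Runs.sub s 8 8 1
    rw [h8, h1, Nat.add_sub_cancel] at r1
    have r2 := Runs.add (s.setReg 8 i) 3 3 0
    rw [State.reg_setReg_of_ne _ _ (by omega), State.reg_setReg_of_ne _ _ (by omega), h3, h0] at r2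
    refine (Runs.seq r1 r2).reaches le_rfl ⟨by omega, hm, ?_, ?_, ?_, ?_, fun j => ⟨?_, ?_⟩⟩
    · rw [State.reg_setReg_of_ne _ _ (by omega), State.reg_setReg_self]
    · rw [State.reg_setReg_of_ne _ _ (by omega), State.reg_setReg_of_ne _ _ (by omega), h0]
    · rw [State.reg_setReg_of_ne _ _ (by omega), State.reg_setReg_of_ne _ _ (by omega), h1]
    · rw [State.reg_setReg_self, show n - i = n - (i + 1) + 1 by omega, Nat.mul_succ]
    · rw [State.reg_setReg_of_ne _ _ (by omega), State.reg_setReg_of_ne _ _ (by omega), (hv j).1]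
    · rw [State.reg_setReg_of_ne _ _ (by omega), State.reg_setReg_of_ne _ _ (by omega), (hv j).2]
  · refine ⟨le_rfl, rfl, State.reg_setReg_self _ _ _, rfl, rfl, ?_, fun j => ⟨?_, ?_⟩⟩
    · rw [Nat.sub_self]
      rfl
    · rw [State.reg_setReg_of_ne _ _ (by omega), State.reg_setReg_of_ne _ _ (by omega)]
      exact if_neg (by omega)
    · rw [State.reg_setReg_of_ne _ _ (by omega), State.reg_setReg_of_ne _ _ (by omega)]
      exact if_neg (by omega)

/-- The adjacency matrix is block `0`; by uniqueness of addresses all other relations start empty.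
-/
theorem memHolds_inputState {n : ℕ} (D : Digraph (Fin n)) {s : State}
    (hs : s.mem = (inputState D).mem) :
    MemHolds (fun k x y => k = 0 ∧ D.Adj x y) s := by
  classical
  intro k x y
  rw [hs]
  change (if _ then 1 else 0) = _
  congr 1
  refine propext ⟨?_, ?_⟩
  · rintro ⟨i, j, hij, hadj⟩
    obtain ⟨h1, rfl, rfl⟩ := address_inj (k' := 0) (x' := i) (y' := j) (by rw [hij]; ring)
    exact ⟨by omega, hadj⟩
  · rintro ⟨rfl, hadj⟩
    exact ⟨x, y, by ring, hadj⟩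

end RAM

/-- Kernel computation is polynomial in clique-acyclic super-orientations of chordal graphs. -/
theorem theorem2 :
    ∃ (P : RAM.Program) (p : Polynomial ℕ),
      ∀ (n : ℕ) (G : SimpleGraph (Fin n)) (D : Digraph (Fin n)),
        G.IsChordalGraph → D.IsSuperOrientation G → D.IsCliqueAcyclic G →
          P.ReturnsKernelWithin D (p.eval n) := by
  classical
  obtain ⟨p, hp⟩ := RAM.Command.kernel.reaches_compile
  refine ⟨.kernel, p + Polynomial.C 3 * Polynomial.X + Polynomial.C 5, ?_⟩
  intro n G D hG hDG hD
  simp only [Polynomial.eval_add, Polynomial.eval_mul, Polynomial.eval_C, Polynomial.eval_X,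
    RAM.Program.ReturnsKernelWithin]
  obtain ⟨t, s, ht, hle, hr, hm⟩ := RAM.reaches_setUp D
  rcases Nat.eq_zero_or_pos n with rfl | hn
  -- For `n = 0` there is no vertex to serve as the default value of variables, so the program skips
  -- the command.
  · refine ⟨_, s, ∅, .seq ht (.if_false hr.dim (.skip s)), by omega, fun i => i.elim0, ?_⟩
    exact ⟨fun u => u.elim0, fun u => u.elim0⟩
  · have : NeZero n := ⟨hn.ne'⟩
    obtain ⟨t', s', ht', hle', -, hm', -⟩ := hp n _ 0 s hr (RAM.memHolds_inputState D hm)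
    obtain ⟨K, hK, hout⟩ := RAM.kernel_eval (A := fun k x y => k = 0 ∧ D.Adj x y) hG hDG hD
      (by simp) (by simp +contextual)
    refine ⟨_, s', K, .seq ht (.if_true (by rw [hr.dim]; omega) ht'), by omega, ?_, hK⟩
    intro i
    -- The output cells are row `0` of relation `0`.
    have := hm' 0 0 i
    simpa [hout] using this
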